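/- Let $\mathbb K$ be an algebraically closed field and let $(I,A,\cdot)$ be a Borcherds–Cartan datum: $I$ is a finite set, $A=(a_{ij})_{i,j\in I}$ is an integer matrix with $a_{ii}\in\{2,0,-2,-4,\dots\}$ and $a_{ij}\le 0$ for $i\ne j$, and there are integers $r_i>0$ with $i\cdot j:=r_ia_{ij}=r_ja_{ji}$ for all $i,j\in I$. Put $I^+=\{i: a_{ii}=2\}$, $I^-=I\setminus I^+$. For $\nu\in\mathbb N[I]$ of height $n$, let $\mathrm{Seq}(\nu)$ be the set of sequences $\mathbf i=i_1\cdots i_n$ in $I$ with $i_1+\dots+i_n=\nu$; the transposition $s_k$ acts on it by exchanging the $k$-th and $(k+1)$-st entries. Let $R(\nu)$ be the associated $\mathbb Z$-graded $\mathbb K$-algebra with generators $1_{\mathbf i}$ (degree $0$), $x_{k,\mathbf i}$ (degree $2r_{i_k}$, $1\le k\le n$) and $\tau_{k,\mathbf i}$ (degree $-i_k\cdot i_{k+1}$, $1\le k<n$), $\mathbf i\in\mathrm{Seq}(\nu)$, and the following relations, where $x_k=\sum_{\mathbf i}x_{k,\mathbf i}$ and $\tau_k=\sum_{\mathbf i}\tau_{k,\mathbf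 i}$: * the $1_{\mathbf i}$ are orthogonal idempotents with sum $1$, $x_{k,\mathbf i}=1_{\mathbf i}x_{k,\mathbf i}1_{\mathbf i}$ and $\tau_{k,\mathbf i}=1_{s_k\mathbf i}\tau_{k,\mathbf i}1_{\mathbf i}$; * $x_kx_l=x_lx_k$; $\tau_kx_l=x_l\tau_k$ for $l\ne k,k+1$; $\tau_k\tau_l=\tau_l\tau_k$ for $|k-l|>1$; * with $i=i_k$, $j=i_{k+1}$: $\tau_k^2 1_{\mathbf i}$ equals $0$ if $i=j$, equals $1_{\mathbf i}$ if $i\ne j$ and $i\cdot j=0$, and equals $(x_k^{-a_{ij}}+x_{k+1}^{-a_{ji}})1_{\mathbf i}$ if $i\neq j$ and $i\cdot j\ne 0$; * $(x_k\tau_k-\tau_kx_{k+1})1_{\mathbf i}=(\tau_kx_k-x_{k+1}\tau_k)1_{\mathbf i}$, and this equals $1_{\mathbf i}$ if $i_k=i_{k+1}\in I^+$ and $0$ otherwise; * $(\tau_k\tau_{k+1}\tau_k-\tau_{k+1}\tau_k\tau_{k+1})1_{\mathbf i}$ equals $\sum_{c=0}^{-a_{ij}-1}x_k^{c}x_{k+2}^{-a_{ij}-1-c}1_{\mathbf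 i}$ if $i=i_k=i_{k+2}\in I^+$, $j=i_{k+1}\ne i$ and $i\cdot j\neq 0$, and equals $0$ otherwise. Let $\psi$ be the anti-involution of $R(\nu)$ fixing $1_{\mathbf i}$, $x_{k,\mathbf i}$ and sending $\tau_{k,\mathbf i}$ to $\tau_{k,s_k\mathbf i}$. For a graded module $M$ put $(M\{m\})_d=M_{d-m}$. Let $\mathbf i$ be a sequence of weight $\nu$ with divided powers, i.e. a concatenation of blocks $i^{(n)}$ with $i\in I^+$, $n\ge0$ (where $i^{(1)}=i$ and $i^{(0)}$ is empty), and single letters $i\in I^-$. Let $\widehat{\mathbf i}\in\mathrm{Seq}(\nu)$ be obtained from $\mathbf i$ by replacing each $i^{(n)}$ by $i\cdots i$ ($n$ times). Let $1_{\mathbf i}\in R(\nu)$ be the product of $1_{\widehat{\mathbf i}}$ and of the elements $x_{p}^{n-1}x_{p+1}^{n-2}\cdots x_{p+n-2}\,\tau_{w_0}$, one for each block $i^{(n)}$, where $p,\dots,p+n-1$ are the positions of that block in $\widehat{\mathbf i}$ and $\tau_{w_0}$ is the product of the $\tau_k$ along a reduced word of the longest permutation of these positions. Put $\langle\mathbf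 i\rangle=\sum r_i\,n(n-1)/2$ (sum over the blocks $i^{(n)}$) and let $P_{\mathbf i}=R(\nu)\psi(1_{\mathbf i})\{-\langle\mathbf i\rangle\}$, a graded left $R(\nu)$-module. **Proposition.** (1) Let $i\in I^+$, $j\in I$, $i\ne j$, $m=1-a_{ij}$ and $\nu=mi+j$. There is an isomorphism of graded left $R(\nu)$-modules $$\bigoplus_{c=0}^{\lfloor m/2\rfloor}P_{i^{(2c)}\,j\,i^{(m-2c)}}\;\simeq\;\bigoplus_{c=0}^{\lfloor (m-1)/2\rfloor}P_{i^{(2c+1)}\,j\,i^{(m-2c-1)}}.$$ (2) For $i,j\in I$ with $i\cdot j=0$ there is an isomorphism of graded left $R(i+j)$-modules $P_{ij}\simeq P_{ji}$. -/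

import Mathlib

open scoped DirectSum

/-- A Borcherds-Cartan datum on `I`: the matrix `A`, the symmetrizing integers `r`, and (see `dot`)
the symmetric bilinear form which they determine. -/
structure BorcherdsCartanDatum (I : Type*) where
  A : Matrix I I ℤ
  r : I → ℤ
  r_pos : ∀ i, 0 < r i
  diag : ∀ i, A i i = 2 ∨ (A i i ≤ 0 ∧ Even (A i i))
  off_diag : ∀ i j, i ≠ j → A i j ≤ 0
  symm : ∀ i j, r i * A i j = r j * A j i

/-- The height of `ν ∈ ℕ[I]`. -/
def height {I : Type*} [Fintype I] (ν : I → ℕ) : ℕ := ∑ i, ν i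

/-- `Seq(ν)`: the sequences of elements of `I` of weight `ν` (positions are numbered from `0`). -/
abbrev WSeq {I : Type*} [Fintype I] [DecidableEq I] (ν : I → ℕ) : Type _ :=
  {s : Fin (height ν) → I // ∑ k, Pi.single (s k) 1 = ν}

namespace WSeq

variable {I : Type*} [Fintype I] [DecidableEq I] {ν : I → ℕ}

/-- The left and the right position of the `k`-th pair of neighbours. -/
def lo (k : Fin (height ν - 1)) : Fin (height ν) := ⟨k.1, by omega⟩

def hi (k : Fin (height ν - 1)) : Fin (height ν) := ⟨k.1 + 1, by omega⟩

/-- `s_k` acting on sequences: exchange of the entries at the `k`-th pair of neighbours. -/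
def sw (k : Fin (height ν - 1)) (s : WSeq ν) : WSeq ν :=
  ⟨fun t => s.1 (Equiv.swap (lo k) (hi k) t), by
    exact (Equiv.sum_comp (Equiv.swap (lo k) (hi k))
      (fun t => (Pi.single (s.1 t) 1 : I → ℕ))).trans s.2⟩

theorem sw_sw (k : Fin (height ν - 1)) (s : WSeq ν) : sw k (sw k s) = s := by
  apply Subtype.ext
  funext t
  simp [sw]

theorem sw_lo (k : Fin (height ν - 1)) (s : WSeq ν) : (sw k s).1 (lo k) = s.1 (hi k) := by
  simp [sw]

theorem sw_hi (k : Fin (height ν - 1)) (s : WSeq ν) : (sw k s).1 (hi k) = s.1 (lo k) := by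
  simp [sw]

theorem sw_of_ne (k : Fin (height ν - 1)) (s : WSeq ν) (t : Fin (height ν))
    (h1 : t ≠ lo k) (h2 : t ≠ hi k) : (sw k s).1 t = s.1 t := by
  simp [sw, Equiv.swap_apply_of_ne_of_ne h1 h2]

theorem sw_eq_self (k : Fin (height ν - 1)) (s : WSeq ν) (h : s.1 (lo k) = s.1 (hi k)) :
    sw k s = s := by
  apply Subtype.ext
  funext t
  by_cases h1 : t = lo k
  · subst h1; rw [sw_lo, h]
  · by_cases h2 : t = hi k
    · subst h2; rw [sw_hi, h]
    · exact sw_of_ne k s t h1 h2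

theorem sw_comm (k l : Fin (height ν - 1)) (s : WSeq ν) (h : k.1 + 1 < l.1) :
    sw k (sw l s) = sw l (sw k s) := by
  have key : ∀ t, Equiv.swap (lo l) (hi l) (Equiv.swap (lo k) (hi k) t) =
      Equiv.swap (lo k) (hi k) (Equiv.swap (lo l) (hi l) t) := by
    have h1 : lo l ≠ lo k := fun e => by simp only [lo, Fin.mk.injEq] at e; omega
    have h2 : lo l ≠ hi k := fun e => by simp only [lo, hi, Fin.mk.injEq] at e; omega
    have h3 : hi l ≠ lo k := fun e => by simp only [lo, hi, Fin.mk.injEq] at e; omega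
    have h4 : hi l ≠ hi k := fun e => by simp only [hi, Fin.mk.injEq] at e; omega
    intro t
    simp only [Equiv.swap_apply_def]
    split_ifs <;> simp_all
  apply Subtype.ext
  funext t
  exact congrArg s.1 (key t)

theorem sw_braid (k l : Fin (height ν - 1)) (s : WSeq ν) (h : l.1 = k.1 + 1) :
    sw k (sw l (sw k s)) = sw l (sw k (sw l s)) := by
  have h1 : lo l = hi k := Fin.ext h
  have h2 : hi l ≠ lo k := fun e => by simp only [lo, hi, Fin.mk.injEq] at e; omega
  have h3 : hi l ≠ hi k := fun e => by simp only [hi, Fin.mk.injEq] at e; omega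
  have h4 : hi k ≠ lo k := fun e => by simp only [lo, hi, Fin.mk.injEq] at e; omega
  have key : ∀ t, Equiv.swap (lo k) (hi k) (Equiv.swap (lo l) (hi l)
      (Equiv.swap (lo k) (hi k) t)) = Equiv.swap (lo l) (hi l) (Equiv.swap (lo k) (hi k)
      (Equiv.swap (lo l) (hi l) t)) := by
    intro t
    rw [h1]
    simp only [Equiv.swap_apply_def]
    split_ifs <;> simp_all
  apply Subtype.ext
  funext t
  exact congrArg s.1 (key t)

theorem sw_braid_apply (k l : Fin (height ν - 1)) (s : WSeq ν) (h : l.1 = k.1 + 1) :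
    (sw k (sw l (sw k s))).1 (lo k) = s.1 (hi l) ∧ (sw k (sw l (sw k s))).1 (hi k) = s.1 (hi k) ∧
      (sw k (sw l (sw k s))).1 (hi l) = s.1 (lo k) := by
  have h1 : lo l = hi k := Fin.ext h
  have h2 : hi l ≠ lo k := fun e => by simp only [lo, hi, Fin.mk.injEq] at e; omega
  have h3 : hi l ≠ hi k := fun e => by simp only [hi, Fin.mk.injEq] at e; omega
  have h4 : lo k ≠ hi k := fun e => by simp only [lo, hi, Fin.mk.injEq] at e; omega
  refine ⟨?_, ?_, ?_⟩
  · rw [sw_lo, ← h1, sw_lo, sw_of_ne k _ _ h2 h3]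
  · rw [sw_hi, sw_of_ne l _ _ (h1 ▸ h4) h2.symm, sw_lo]
  · rw [sw_of_ne k _ _ h2 h3, sw_hi, h1, sw_hi]

end WSeq

namespace BorcherdsCartanDatum

variable {I : Type*} [Fintype I] [DecidableEq I] (D : BorcherdsCartanDatum I)

/-- The form `i · j = r_i a_{ij} = r_j a_{ji}` on the basis `I` of `ℤ[I]`. -/
def dot (i j : I) : ℤ := D.r i * D.A i j

/-- `i ∈ I⁺`; the other indices, those with `a_{ii} ≤ 0`, form `I⁻`. -/
def IsReal (i : I) : Prop := D.A i i = 2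

/-- `-a_{ij}` as a natural number (used for `i ≠ j` only). -/
def negA (i j : I) : ℕ := (-D.A i j).toNat

/-- The generating diagrams of `R(ν)`: `1_s`, `x_{k,s}` and `τ_{k,s}`; the sequence `s` is read at
the bottom of the diagram, and the top of `τ_{k,s}` is `s_k(s)`. -/
inductive Gen (ν : I → ℕ) : Type _ where
  | e (s : WSeq ν) : Gen ν
  | x (k : Fin (height ν)) (s : WSeq ν) : Gen ν
  | tau (k : Fin (height ν - 1)) (s : WSeq ν) : Gen ν

/-- The degrees of the generators. -/
def genDeg {ν : I → ℕ} : Gen ν → ℤ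
  | .e _ => 0
  | .x k s => 2 * D.r (s.1 k)
  | .tau k s => -D.dot (s.1 (WSeq.lo k)) (s.1 (WSeq.hi k))

section Relations

variable (K : Type*) [Field K] {ν : I → ℕ}

/-- The generators as elements of the free algebra. -/
def fe (s : WSeq ν) : FreeAlgebra K (Gen ν) := FreeAlgebra.ι K (.e s)

def fx (k : Fin (height ν)) (s : WSeq ν) : FreeAlgebra K (Gen ν) := FreeAlgebra.ι K (.x k s)

def ftau (k : Fin (height ν - 1)) (s : WSeq ν) : FreeAlgebra K (Gen ν) :=
  FreeAlgebra.ι K (.tau k s)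

open WSeq in
/-- The defining relations of `R(ν)`. A product `a * b` is the diagram `a` on top of `b`. -/
inductive Rel : FreeAlgebra K (Gen ν) → FreeAlgebra K (Gen ν) → Prop
  -- concatenation of diagrams
  | e_mul_self (s : WSeq ν) : Rel (fe K s * fe K s) (fe K s)
  | e_mul_ne (s t : WSeq ν) (h : s ≠ t) : Rel (fe K s * fe K t) 0
  | e_sum : Rel (∑ s : WSeq ν, fe K s) 1
  | e_x (k : Fin (height ν)) (s : WSeq ν) : Rel (fe K s * fx K k s) (fx K k s)
  | x_e (k : Fin (height ν)) (s : WSeq ν) : Rel (fx K k s * fe K s) (fx K k s)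
  | e_tau (k : Fin (height ν - 1)) (s : WSeq ν) :
      Rel (fe K (sw k s) * ftau K k s) (ftau K k s)
  | tau_e (k : Fin (height ν - 1)) (s : WSeq ν) : Rel (ftau K k s * fe K s) (ftau K k s)
  -- planar isotopy: distant dots and crossings slide past each other
  | x_comm (k l : Fin (height ν)) (s : WSeq ν) : Rel (fx K k s * fx K l s) (fx K l s * fx K k s)
  | x_tau_far (l : Fin (height ν)) (k : Fin (height ν - 1)) (s : WSeq ν)
      (h1 : l ≠ lo k) (h2 : l ≠ hi k) :
      Rel (fx K l (sw k s) * ftau K k s) (ftau K k s * fx K l s)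
  | tau_far (k l : Fin (height ν - 1)) (s : WSeq ν) (h : k.1 + 1 < l.1) :
      Rel (ftau K k (sw l s) * ftau K l s) (ftau K l (sw k s) * ftau K k s)
  -- double crossings
  | tau_sq_eq (k : Fin (height ν - 1)) (s : WSeq ν) (h : s.1 (lo k) = s.1 (hi k)) :
      Rel (ftau K k (sw k s) * ftau K k s) 0
  | tau_sq_orth (k : Fin (height ν - 1)) (s : WSeq ν) (h : s.1 (lo k) ≠ s.1 (hi k))
      (h0 : D.dot (s.1 (lo k)) (s.1 (hi k)) = 0) :
      Rel (ftau K k (sw k s) * ftau K k s) (fe K s)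
  | tau_sq (k : Fin (height ν - 1)) (s : WSeq ν) (h : s.1 (lo k) ≠ s.1 (hi k))
      (h0 : D.dot (s.1 (lo k)) (s.1 (hi k)) ≠ 0) :
      Rel (ftau K k (sw k s) * ftau K k s)
        (fx K (lo k) s ^ D.negA (s.1 (lo k)) (s.1 (hi k)) +
          fx K (hi k) s ^ D.negA (s.1 (hi k)) (s.1 (lo k)))
  -- a dot moving through a crossing of two strands of the same colour in `I⁺`
  | dot_real_left (k : Fin (height ν - 1)) (s : WSeq ν) (h : s.1 (lo k) = s.1 (hi k))
      (hr : D.IsReal (s.1 (lo k))) :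
      Rel (fx K (lo k) (sw k s) * ftau K k s - ftau K k s * fx K (hi k) s) (fe K s)
  | dot_real_right (k : Fin (height ν - 1)) (s : WSeq ν) (h : s.1 (lo k) = s.1 (hi k))
      (hr : D.IsReal (s.1 (lo k))) :
      Rel (ftau K k s * fx K (lo k) s - fx K (hi k) (sw k s) * ftau K k s) (fe K s)
  -- a dot moving through any other crossing
  | dot_left (k : Fin (height ν - 1)) (s : WSeq ν)
      (h : ¬(s.1 (lo k) = s.1 (hi k) ∧ D.IsReal (s.1 (lo k)))) :
      Rel (fx K (lo k) (sw k s) * ftau K k s) (ftau K k s * fx K (hi k) s)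
  | dot_right (k : Fin (height ν - 1)) (s : WSeq ν)
      (h : ¬(s.1 (lo k) = s.1 (hi k) ∧ D.IsReal (s.1 (lo k)))) :
      Rel (ftau K k s * fx K (lo k) s) (fx K (hi k) (sw k s) * ftau K k s)
  -- braids of three strands with colours `i j i`, where `i ∈ I⁺`, `i ≠ j` and `i · j ≠ 0`
  | braid_real (k l : Fin (height ν - 1)) (hkl : l.1 = k.1 + 1) (s : WSeq ν)
      (hs : s.1 (lo k) = s.1 (hi l)) (hr : D.IsReal (s.1 (lo k))) (hne : s.1 (lo k) ≠ s.1 (hi k))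
      (h0 : D.dot (s.1 (lo k)) (s.1 (hi k)) ≠ 0) :
      Rel (ftau K k (sw l (sw k s)) * ftau K l (sw k s) * ftau K k s -
          ftau K l (sw k (sw l s)) * ftau K k (sw l s) * ftau K l s)
        (∑ c ∈ Finset.range (D.negA (s.1 (lo k)) (s.1 (hi k))),
          fx K (lo k) s ^ c * fx K (hi l) s ^ (D.negA (s.1 (lo k)) (s.1 (hi k)) - 1 - c) * fe K s)
  -- all other braids
  | braid (k l : Fin (height ν - 1)) (hkl : l.1 = k.1 + 1) (s : WSeq ν)
      (h : ¬(s.1 (lo k) = s.1 (hi l) ∧ D.IsReal (s.1 (lo k)) ∧ s.1 (lo k) ≠ s.1 (hi k) ∧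
        D.dot (s.1 (lo k)) (s.1 (hi k)) ≠ 0)) :
      Rel (ftau K k (sw l (sw k s)) * ftau K l (sw k s) * ftau K k s)
        (ftau K l (sw k (sw l s)) * ftau K k (sw l s) * ftau K l s)

end Relations

/-- The algebra `R(ν)`. -/
abbrev KLR (K : Type*) [Field K] (ν : I → ℕ) : Type _ := RingQuot (D.Rel K (ν := ν))

namespace KLR

variable (K : Type*) [Field K] {ν : I → ℕ}

/-- The generators as elements of `R(ν)`. -/
noncomputable def gen (g : Gen ν) : D.KLR K ν :=
  RingQuot.mkAlgHom K (D.Rel K) (FreeAlgebra.ι K g)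

/-- The idempotent `1_s`. -/
noncomputable def e (s : WSeq ν) : D.KLR K ν := gen D K (.e s)

noncomputable def x (k : Fin (height ν)) (s : WSeq ν) : D.KLR K ν := gen D K (.x k s)

noncomputable def tau (k : Fin (height ν - 1)) (s : WSeq ν) : D.KLR K ν := gen D K (.tau k s)

/-- The homogeneous component of `R(ν)` of degree `d`: the span of the products of generators of
total degree `d`. -/
def grading (d : ℤ) : Submodule K (D.KLR K ν) :=
  Submodule.span K {z | ∃ w : List (Gen ν), (w.map D.genDeg).sum = d ∧ (w.map (gen D K)).prod = z}

/-- The image of a generator under the flip: `τ_{k,s}` becomes `τ_{k,s_k(s)}`. -/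
def flipGen : Gen ν → Gen ν
  | .e s => .e s
  | .x k s => .x k s
  | .tau k s => .tau k (WSeq.sw k s)

section Flip

variable {K} {D}

theorem rel_eq {a b : FreeAlgebra K (Gen ν)} (h : D.Rel K a b) :
    RingQuot.mkAlgHom K (D.Rel K) a = RingQuot.mkAlgHom K (D.Rel K) b :=
  RingQuot.mkAlgHom_rel K h

variable (K) (D) in
/-- The flip on the free algebra, with values in `R(ν)`. -/
noncomputable def flipFree : FreeAlgebra K (Gen ν) →ₐ[K] (D.KLR K ν)ᵐᵒᵖ :=
  FreeAlgebra.lift K fun g => MulOpposite.op (gen D K (flipGen g))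

theorem flipFree_e (s : WSeq ν) : flipFree D K (fe K s) =
    MulOpposite.op (RingQuot.mkAlgHom K (D.Rel K) (fe K s)) := by
  simp [flipFree, fe, flipGen, gen]

theorem flipFree_x (k : Fin (height ν)) (s : WSeq ν) : flipFree D K (fx K k s) =
    MulOpposite.op (RingQuot.mkAlgHom K (D.Rel K) (fx K k s)) := by
  simp [flipFree, fx, flipGen, gen]

theorem flipFree_tau (k : Fin (height ν - 1)) (s : WSeq ν) : flipFree D K (ftau K k s) =
    MulOpposite.op (RingQuot.mkAlgHom K (D.Rel K) (ftau K k (WSeq.sw k s))) := by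
  simp [flipFree, ftau, flipGen, gen]

open WSeq in
theorem flipFree_rel {a b : FreeAlgebra K (Gen ν)} (h : D.Rel K a b) :
    flipFree D K a = flipFree D K b := by
  apply MulOpposite.unop_injective
  cases h with
  | e_mul_self s =>
    simpa [flipFree_e] using rel_eq (Rel.e_mul_self (D := D) (K := K) s)
  | e_mul_ne s t h =>
    simpa [flipFree_e] using rel_eq (Rel.e_mul_ne (D := D) (K := K) t s h.symm)
  | e_sum =>
    simpa [flipFree_e] using rel_eq (Rel.e_sum (D := D) (K := K) (ν := ν))
  | e_x k s =>
    simpa [flipFree_e, flipFree_x] using rel_eq (Rel.x_e (D := D) (K := K) k s)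
  | x_e k s =>
    simpa [flipFree_e, flipFree_x] using rel_eq (Rel.e_x (D := D) (K := K) k s)
  | e_tau k s =>
    simpa [flipFree_e, flipFree_tau] using rel_eq (Rel.tau_e (D := D) (K := K) k (sw k s))
  | tau_e k s =>
    simpa [flipFree_e, flipFree_tau, sw_sw] using
      rel_eq (Rel.e_tau (D := D) (K := K) k (sw k s))
  | x_comm k l s =>
    simpa [flipFree_x] using rel_eq (Rel.x_comm (D := D) (K := K) l k s)
  | x_tau_far l k s h1 h2 =>
    simpa [flipFree_x, flipFree_tau, sw_sw] using
      (rel_eq (Rel.x_tau_far (D := D) (K := K) l k (sw k s) h1 h2)).symm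
  | tau_far k l s h =>
    have := rel_eq (Rel.tau_far (D := D) (K := K) k l (sw k (sw l s)) h)
    rw [sw_sw, sw_comm k l s h, sw_sw] at this
    simpa [flipFree_tau, sw_comm k l s h] using this.symm
  | tau_sq_eq k s h =>
    simpa [flipFree_tau, sw_sw] using rel_eq (Rel.tau_sq_eq (D := D) (K := K) k s h)
  | tau_sq_orth k s h h0 =>
    simpa [flipFree_e, flipFree_tau, sw_sw] using
      rel_eq (Rel.tau_sq_orth (D := D) (K := K) k s h h0)
  | tau_sq k s h h0 =>
    simpa [flipFree_x, flipFree_tau, sw_sw] using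
      rel_eq (Rel.tau_sq (D := D) (K := K) k s h h0)
  | dot_real_left k s h hr =>
    simpa [flipFree_e, flipFree_x, flipFree_tau, sw_eq_self k s h] using
      rel_eq (Rel.dot_real_right (D := D) (K := K) k s h hr)
  | dot_real_right k s h hr =>
    simpa [flipFree_e, flipFree_x, flipFree_tau, sw_eq_self k s h] using
      rel_eq (Rel.dot_real_left (D := D) (K := K) k s h hr)
  | dot_left k s h =>
    have h' : ¬((sw k s).1 (lo k) = (sw k s).1 (hi k) ∧ D.IsReal ((sw k s).1 (lo k))) := by
      rw [sw_lo, sw_hi]; rintro ⟨h1, h2⟩; exact h ⟨h1.symm, h1 ▸ h2⟩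
    simpa [flipFree_x, flipFree_tau, sw_sw] using
      rel_eq (Rel.dot_right (D := D) (K := K) k (sw k s) h')
  | dot_right k s h =>
    have h' : ¬((sw k s).1 (lo k) = (sw k s).1 (hi k) ∧ D.IsReal ((sw k s).1 (lo k))) := by
      rw [sw_lo, sw_hi]; rintro ⟨h1, h2⟩; exact h ⟨h1.symm, h1 ▸ h2⟩
    simpa [flipFree_x, flipFree_tau, sw_sw] using
      rel_eq (Rel.dot_left (D := D) (K := K) k (sw k s) h')
  | braid_real k l hkl s hs hr hne h0 =>
    have hb := sw_braid k l s hkl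
    have ht : sw k (sw l (sw k s)) = s := by
      obtain ⟨h1, h2, h3⟩ := sw_braid_apply k l s hkl
      apply Subtype.ext
      funext u
      by_cases hu1 : u = lo k
      · rw [hu1, h1, hs]
      · by_cases hu2 : u = hi k
        · rw [hu2, h2]
        · by_cases hu3 : u = hi l
          · rw [hu3, h3, hs]
          · have hlk : lo l = hi k := Fin.ext hkl
            rw [sw_of_ne k _ u hu1 hu2, sw_of_ne l _ u (hlk ▸ hu2) hu3, sw_of_ne k _ u hu1 hu2]
    have k1 : sw l (sw k s) = sw k s := by
      have := congrArg (sw k) ht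
      rwa [sw_sw] at this
    have k2 : sw k (sw l s) = sw l s := by
      have := congrArg (sw l) (hb.symm.trans ht)
      rwa [sw_sw] at this
    have hrel := rel_eq (Rel.braid_real (D := D) (K := K) k l hkl s hs hr hne h0)
    have c1 : Commute (RingQuot.mkAlgHom K (D.Rel K) (fx K (lo k) s))
        (RingQuot.mkAlgHom K (D.Rel K) (fx K (hi l) s)) := by
      simpa [Commute, SemiconjBy] using rel_eq (Rel.x_comm (D := D) (K := K) (lo k) (hi l) s)
    have c2 : ∀ u, Commute (RingQuot.mkAlgHom K (D.Rel K) (fe K s))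
        (RingQuot.mkAlgHom K (D.Rel K) (fx K u s)) := by
      intro u
      have e1 := rel_eq (Rel.e_x (D := D) (K := K) u s)
      have e2 := rel_eq (Rel.x_e (D := D) (K := K) u s)
      rw [map_mul] at e1 e2
      exact e1.trans e2.symm
    have hsum : ∀ c d : ℕ,
        RingQuot.mkAlgHom K (D.Rel K) (fe K s) *
          (RingQuot.mkAlgHom K (D.Rel K) (fx K (hi l) s) ^ d *
            RingQuot.mkAlgHom K (D.Rel K) (fx K (lo k) s) ^ c) =
        RingQuot.mkAlgHom K (D.Rel K) (fx K (lo k) s) ^ c *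
          RingQuot.mkAlgHom K (D.Rel K) (fx K (hi l) s) ^ d *
          RingQuot.mkAlgHom K (D.Rel K) (fe K s) := by
      intro c d
      rw [(c1.pow_pow c d).eq]
      exact (((c2 _).pow_right d).mul_right ((c2 _).pow_right c)).eq
    simpa [flipFree_e, flipFree_x, flipFree_tau, k1, k2, sw_sw, hsum, mul_assoc] using hrel
  | braid k l hkl s h =>
    have hb := sw_braid k l s hkl
    have hv := sw_braid_apply k l s hkl
    have h' : ¬((sw k (sw l (sw k s))).1 (lo k) = (sw k (sw l (sw k s))).1 (hi l) ∧
        D.IsReal ((sw k (sw l (sw k s))).1 (lo k)) ∧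
        (sw k (sw l (sw k s))).1 (lo k) ≠ (sw k (sw l (sw k s))).1 (hi k) ∧
        D.dot ((sw k (sw l (sw k s))).1 (lo k)) ((sw k (sw l (sw k s))).1 (hi k)) ≠ 0) := by
      rw [hv.1, hv.2.1, hv.2.2]
      rintro ⟨h1, h2, h3, h4⟩
      rw [h1] at h2 h3 h4
      exact h ⟨h1.symm, h2, h3, h4⟩
    have hrel := rel_eq (Rel.braid (D := D) (K := K) k l hkl (sw k (sw l (sw k s))) h')
    rw [sw_sw, sw_sw] at hrel
    rw [hb, sw_sw, sw_sw] at hrel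
    simpa [flipFree_tau, hb, mul_assoc] using hrel

end Flip

/-- The anti-involution `ψ` of `R(ν)` which flips the diagrams about a horizontal axis, as a
homomorphism to the opposite algebra. -/
noncomputable def psiHom : D.KLR K ν →ₐ[K] (D.KLR K ν)ᵐᵒᵖ :=
  RingQuot.liftAlgHom K ⟨flipFree D K, fun _ _ h => flipFree_rel h⟩

noncomputable def psi (z : D.KLR K ν) : D.KLR K ν := (psiHom D K z).unop

/-- The diagram with a dot on the strand at position `k`, and the diagram in which the strands at
the positions `k` and `k + 1` cross, each summed over all sequences of weight `ν`
(`0` if there is no such strand). -/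
noncomputable def X (k : ℕ) : D.KLR K ν :=
  if h : k < height ν then ∑ s : WSeq ν, x D K ⟨k, h⟩ s else 0

noncomputable def T (k : ℕ) : D.KLR K ν :=
  if h : k < height ν - 1 then ∑ s : WSeq ν, tau D K ⟨k, h⟩ s else 0

/-- The reduced expression `τ_p (τ_{p+1} τ_p) ⋯ (τ_{p+n-2} ⋯ τ_p)` of the longest permutation of
the `n` strands at the positions `p, …, p + n - 1`. -/
noncomputable def longest (p : ℕ) : ℕ → D.KLR K ν
  | 0 => 1
  | n + 1 => longest p n * ((List.range n).reverse.map fun t => T D K (p + t)).prod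

/-- The element `x_1^{n-1} x_2^{n-2} ⋯ x_{n-1} ∂_{w_0}`, on the `n` strands at the positions
`p, …, p + n - 1`. -/
noncomputable def nilIdem (p n : ℕ) : D.KLR K ν :=
  ((List.range n).map fun t => X D K (p + t) ^ (n - 1 - t)).prod * longest D K p n

/-- The horizontal composition of the elements `nilIdem`, one for each block, from position `p`. -/
noncomputable def blockIdem (p : ℕ) : List (I × ℕ) → D.KLR K ν
  | [] => 1
  | b :: bs => nilIdem D K p b.2 * blockIdem (p + b.2) bs

end KLR

/-- `Seqd(ν)`: the sequences of weight `ν` with divided powers, written as lists of blocks `(i, n)`.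
A block `(i, n)` with `i ∈ I⁺` stands for `i^{(n)}`, and `i^{(1)}` is the same as `i`; for
`i ∈ I⁻` only `n = 1` is allowed. -/
structure DSeq (ν : I → ℕ) where
  blocks : List (I × ℕ)
  real_or_one : ∀ b ∈ blocks, D.IsReal b.1 ∨ b.2 = 1
  weight : (blocks.map fun b => (Pi.single b.1 b.2 : I → ℕ)).sum = ν

namespace DSeq

variable {D} {ν : I → ℕ} (s : D.DSeq ν)

/-- The list of entries of the sequence `ŝ` without divided powers. -/
def hatList : List I := s.blocks.flatMap fun b => List.replicate b.2 b.1

theorem sum_hatList : (s.hatList.map fun i => (Pi.single i 1 : I → ℕ)).sum = ν := by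
  have h : ∀ l : List (I × ℕ), ((l.flatMap fun b => List.replicate b.2 b.1).map
      fun i => (Pi.single i 1 : I → ℕ)).sum =
        (l.map fun b => (Pi.single b.1 b.2 : I → ℕ)).sum := by
    intro l
    induction l with
    | nil => simp
    | cons b bs ih =>
      simp only [List.flatMap_cons, List.map_append, List.sum_append, ih, List.map_cons,
        List.sum_cons, List.map_replicate, List.sum_replicate]
      congr 1
      rw [← Pi.single_smul]
      simp
  exact (h s.blocks).trans s.weight

theorem length_hatList : s.hatList.length = height ν := by
  have h : ∀ l : List I,
      height ((l.map fun i => (Pi.single i 1 : I → ℕ)).sum) = l.length := by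
    intro l
    induction l with
    | nil => simp [height]
    | cons a l ih =>
      simp only [height] at ih
      simp [height, Finset.sum_add_distrib, ih, add_comm]
  rw [← h, s.sum_hatList]

/-- The sequence `ŝ ∈ Seq(ν)`. -/
def hat : WSeq ν :=
  ⟨fun k => s.hatList.get (k.cast s.length_hatList.symm), by
    refine Eq.trans ?_ s.sum_hatList
    rw [← Fin.sum_univ_fun_getElem]
    exact Fintype.sum_equiv (finCongr s.length_hatList.symm) _ _ (fun _ => rfl)⟩

/-- The idempotent `1_s` of `R(ν)`. -/
noncomputable def idem (K : Type*) [Field K] : D.KLR K ν :=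
  KLR.e D K s.hat * KLR.blockIdem D K 0 s.blocks

/-- The number `⟨s⟩ = ∑ r_i n (n - 1) / 2`, the sum over the blocks `(i, n)`. -/
def shift : ℤ := (s.blocks.map fun b => ((b.2 * (b.2 - 1) / 2 : ℕ) : ℤ) * D.r b.1).sum

/-- The left `R(ν)`-module `P_s = R(ν) ψ(1_s)`. -/
noncomputable def P (K : Type*) [Field K] : Submodule (D.KLR K ν) (D.KLR K ν) :=
  Submodule.span (D.KLR K ν) {KLR.psi D K (s.idem K)}

/-- The grading of `P_s = R(ν) ψ(1_s) {-⟨s⟩}`, where `(M{m})_d = M_{d-m}`. -/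
noncomputable def PGrading (K : Type*) [Field K] (d : ℤ) : Submodule K (s.P K) :=
  (KLR.grading D K (d - -s.shift)).comap ((s.P K).subtype.restrictScalars K)

end DSeq

/-- The sequence `i^{(a)} j i^{(b)}` for `i ∈ I⁺`. -/
def serreSeq {i : I} (hi : D.IsReal i) (j : I) (a b m : ℕ) (h : a + b = m) :
    D.DSeq (Pi.single i m + Pi.single j 1) where
  blocks := [(i, a), (j, 1), (i, b)]
  real_or_one := by simp [hi]
  weight := by
    subst h
    simp [Pi.single_add]
    abel

/-- The sequence `i j`. -/
def pairSeq (i j : I) : D.DSeq (Pi.single i 1 + Pi.single j 1) where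
  blocks := [(i, 1), (j, 1)]
  real_or_one := by simp
  weight := by simp

/-- The sequence `j i`. -/
def pairSeq' (i j : I) : D.DSeq (Pi.single i 1 + Pi.single j 1) where
  blocks := [(j, 1), (i, 1)]
  real_or_one := by simp
  weight := by simp [add_comm]

end BorcherdsCartanDatum

/-- The grading of a direct sum of graded modules. -/
def directSumGrading (K : Type*) [Field K] {ι : Type*} {M : ι → Type*}
    [∀ c, AddCommMonoid (M c)] [∀ c, Module K (M c)] (G : ∀ c, ℤ → Submodule K (M c)) (d : ℤ) :
    Submodule K (⨁ c, M c) :=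
  ⨅ c, (G c d).comap (DirectSum.component K ι M c)

/-- Two `R`-modules with the gradings `G` and `H` are isomorphic as graded `R`-modules. -/
def GradedIso {K : Type*} [Field K] (R : Type*) [Ring R] {M N : Type*} [AddCommMonoid M]
    [AddCommMonoid N] [Module K M] [Module K N] [Module R M] [Module R N]
    (G : ℤ → Submodule K M) (H : ℤ → Submodule K N) : Prop :=
  ∃ f : M ≃ₗ[R] N, ∀ d z, z ∈ G d ↔ f z ∈ H d

/-! Write ε_a for the image under ψ of the idempotent of i^{(a)} j i^{(m-a)}, so that the modules in
question are the left ideals R(ν)ε_a up to shift. A homomorphism R(ν)ε_a → R(ν)ε_b is right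
multiplication by an element of ε_a R(ν) ε_b. The isomorphism and its inverse are given by explicit
matrices of such elements.

Two families suffice. The element U_a (`up`) in ε_a R(ν) ε_{a+1} and the element D_a (`down`) in
ε_{a+1} R(ν) ε_a let one strand of colour i leave a thick strand, cross the strand of colour j and
merge with the other thick strand. They satisfy U_a U_{a+1} = 0, D_{a+1} D_a = 0, U_a D_a - D_{a-1}
U_{a-1} = (-1)^a ε_a for 0 ≤ a ≤ m, where U_m and the terms of index -1 are read as 0. Hence the
matrix with entries (-1)^a U_a at (a, a+1) and D_a at (a+1, a) has square diag(ε_a)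
(`serreMatrix_sq`). It links only indices of opposite parity, so its even-to-odd and odd-to-even
parts are mutually inverse; this is part (1).

The two vanishing statements hold because two strands crossing j one after the other can be braided
so that they cross inside a thick strand, where every crossing gives zero (`desc_mul_desc`,
`asc_mul_asc`). In the third relation, for 0 < a < m, the two products differ by the braid relation
for i j i (`desc_asc_sub_asc_desc`). The error term is a sum of monomials x^c y^d with c + d = m -
2, where x and y are the dots on the strands next to j. Crossings act on a thick strand as Demazure
operators, and the iterated operators kill a power of x of exponent below a - 1 and a power of y of
exponent below m - a - 1. As these two bounds add up to m - 2, exactly one monomial survives, with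
coefficient ±1. For a = 0 and a = m the quadratic relation for τ² replaces the braid relation
(`desc_asc_first`, `asc_desc_last`).

The degree of U_a is r_i(2a + 1 - m), which is the difference of the two shifts, and D_a has the
opposite degree; so the isomorphism is graded. In part (2), for i ≠ j, the crossing of the two
strands has degree 0 and squares to the identity. -/

namespace NilHecke

/-! ### Descending, ascending and longest words in the crossings -/

variable {R : Type*} [Ring R]

/-- The descending product `t_{p+n-1} ⋯ t_{p+1} t_p`. -/
def desc (t : ℕ → R) (p : ℕ) : ℕ → R
  | 0 => 1
  | n + 1 => t (p + n) * desc t p n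

/-- The ascending product `t_p t_{p+1} ⋯ t_{p+n-1}`. -/
def asc (t : ℕ → R) (p : ℕ) : ℕ → R
  | 0 => 1
  | n + 1 => asc t p n * t (p + n)

/-- The product of crossings along a reduced word of the longest permutation of the `n` strands
`p, …, p + n - 1`. -/
def long (t : ℕ → R) (p : ℕ) : ℕ → R
  | 0 => 1
  | n + 1 => long t p n * desc t p n

/-- The staircase monomial `x_p^{n-1} x_{p+1}^{n-2} ⋯ x_{p+n-2}`. -/
def stair (x : ℕ → R) : ℕ → ℕ → R
  | _, 0 => 1
  | p, n + 1 => x p ^ n * stair x (p + 1) n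

section Words

variable {t x : ℕ → R} {p n : ℕ} {z : R}

theorem commute_desc (h : ∀ k, p ≤ k → k < p + n → Commute z (t k)) :
    Commute z (desc t p n) := by
  induction n with
  | zero => exact Commute.one_right z
  | succ n ih =>
    exact (h _ (by omega) (by omega)).mul_right (ih fun k h1 h2 => h k h1 (by omega))

theorem commute_asc (h : ∀ k, p ≤ k → k < p + n → Commute z (t k)) :
    Commute z (asc t p n) := by
  induction n with
  | zero => exact Commute.one_right z
  | succ n ih =>
    exact (ih fun k h1 h2 => h k h1 (by omega)).mul_right (h _ (by omega) (by omega))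

theorem commute_long (h : ∀ k, p ≤ k → k + 1 < p + n → Commute z (t k)) :
    Commute z (long t p n) := by
  induction n with
  | zero => exact Commute.one_right z
  | succ n ih =>
    exact (ih fun k h1 h2 => h k h1 (by omega)).mul_right
      (commute_desc fun k h1 h2 => h k h1 (by omega))

theorem commute_stair (h : ∀ k, p ≤ k → k < p + n → Commute z (x k)) :
    Commute z (stair x p n) := by
  induction n generalizing p with
  | zero => exact Commute.one_right z
  | succ n ih =>
    exact ((h _ le_rfl (by omega)).pow_right n).mul_right
      (ih fun k h1 h2 => h k (by omega) (by omega))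

theorem desc_succ' (t : ℕ → R) (p n : ℕ) : desc t p (n + 1) = desc t (p + 1) n * t p := by
  induction n with
  | zero => simp [desc]
  | succ n ih =>
    rw [desc, ih, desc, ← mul_assoc, show p + 1 + n = p + (n + 1) by omega]

theorem asc_succ' (t : ℕ → R) (p n : ℕ) : asc t p (n + 1) = t p * asc t (p + 1) n := by
  induction n with
  | zero => simp [asc]
  | succ n ih =>
    rw [asc, ih, asc, mul_assoc, show p + 1 + n = p + (n + 1) by omega]

/-- The recursion defining `long` peels off a strand on the right; this one peels it off on the
left. Passing between them needs only the commutation of distant crossings, so it is valid in all of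
R(ν), not merely on sequences where a braid relation is available. -/
theorem long_succ_eq_asc_mul
    (h : ∀ k l, p ≤ k → k + 1 < l → l < p + n → Commute (t k) (t l)) :
    long t p (n + 1) = asc t p n * long t p n := by
  induction n with
  | zero => simp [long, asc, desc]
  | succ n ih =>
    have hc : Commute (t (p + n)) (long t p n) :=
      commute_long fun k h1 h2 => (h k _ h1 (by omega) (by omega)).symm
    have e := ih fun k l h1 h2 h3 => h k l h1 h2 (by omega)
    rw [long, e, desc, asc]
    calc _ = asc t p n * (long t p n * t (p + n)) * desc t p n := by noncomm_ring
      _ = _ := by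
        rw [← hc.eq, ← e, show long t p (n + 1) = long t p n * desc t p n from rfl]
        noncomm_ring

/-- The nilHecke relations hold for the cut-down crossings `T k * E` only. This lemma and the next
two carry results about words in these back to words in `T`: all the idempotents can be gathered at
the right end. -/
theorem desc_mul_of_commute {T : ℕ → R} {E : R} (hE : E * E = E)
    (ht : ∀ k, p ≤ k → k < p + n → t k = T k * E)
    (hc : ∀ k, p ≤ k → k < p + n → Commute E (T k)) : desc t p n * E = desc T p n * E := by
  induction n with
  | zero => rfl
  | succ n ih =>
    rw [desc, desc, mul_assoc, ih (fun k h1 h2 => ht k h1 (by omega))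
      (fun k h1 h2 => hc k h1 (by omega)), ht _ (by omega) (by omega)]
    have := commute_desc (z := E) (t := T) (p := p) (n := n)
      fun k h1 h2 => hc k h1 (by omega)
    rw [← this.eq, mul_assoc, ← mul_assoc E E, hE, mul_assoc, this.eq]

theorem asc_mul_of_commute {T : ℕ → R} {E : R} (hE : E * E = E)
    (ht : ∀ k, p ≤ k → k < p + n → t k = T k * E)
    (hc : ∀ k, p ≤ k → k < p + n → Commute E (T k)) : asc t p n * E = asc T p n * E := by
  induction n with
  | zero => rfl
  | succ n ih =>
    have h1 := hc (p + n) (by omega) (by omega)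
    have h2 := ih (fun k h1 h2 => ht k h1 (by omega)) (fun k h1 h2 => hc k h1 (by omega))
    rw [asc, asc, ht _ (by omega) (by omega), ← h1.eq, ← mul_assoc, h2, mul_assoc, mul_assoc,
      mul_assoc, ← h1.eq, ← mul_assoc E, hE]

theorem long_mul_of_commute {T : ℕ → R} {E : R} (hE : E * E = E)
    (ht : ∀ k, p ≤ k → k + 1 < p + n → t k = T k * E)
    (hc : ∀ k, p ≤ k → k + 1 < p + n → Commute E (T k)) : long t p n * E = long T p n * E := by
  induction n with
  | zero => rfl
  | succ n ih =>
    have h1 := desc_mul_of_commute (p := p) (n := n) hE (fun k h1 h2 => ht k h1 (by omega))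
      (fun k h1 h2 => hc k h1 (by omega))
    have h2 := ih (fun k h1 h2 => ht k h1 (by omega)) (fun k h1 h2 => hc k h1 (by omega))
    have h3 : Commute E (desc T p n) := commute_desc fun k h1 h2 => hc k h1 (by omega)
    rw [long, long, mul_assoc, h1, ← h3.eq, ← mul_assoc, h2, mul_assoc, mul_assoc, h3.eq]

end Words

/-! ### The nilHecke algebra: Demazure operators and the idempotent of a thick strand -/

/-- The relations of the nilHecke algebra on the strands `p, …, p + n - 1`, in the corner of the
idempotent `E`. -/
structure Relations (E : R) (t x : ℕ → R) (p n : ℕ) : Prop where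
  idem : E * E = E
  e_t : ∀ k, p ≤ k → k + 1 < p + n → E * t k = t k
  t_e : ∀ k, p ≤ k → k + 1 < p + n → t k * E = t k
  e_x : ∀ k, Commute E (x k)
  x_x : ∀ k l, Commute (x k) (x l)
  x_t : ∀ k l, p ≤ k → k + 1 < p + n → l ≠ k → l ≠ k + 1 → Commute (x l) (t k)
  t_t : ∀ k l, p ≤ k → k + 1 < l → l + 1 < p + n → Commute (t k) (t l)
  sq : ∀ k, p ≤ k → k + 1 < p + n → t k * t k = 0
  braid : ∀ k, p ≤ k → k + 2 < p + n → t k * t (k + 1) * t k = t (k + 1) * t k * t (k + 1)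
  dot_left : ∀ k, p ≤ k → k + 1 < p + n → t k * x k = x (k + 1) * t k + E
  dot_right : ∀ k, p ≤ k → k + 1 < p + n → t k * x (k + 1) = x k * t k - E

namespace Relations

variable {E : R} {t x : ℕ → R} {p n : ℕ}

theorem mono (h : Relations E t x p n) {q l : ℕ} (h1 : p ≤ q) (h2 : q + l ≤ p + n) :
    Relations E t x q l where
  idem := h.idem
  e_t k _ _ := h.e_t k (by omega) (by omega)
  t_e k _ _ := h.t_e k (by omega) (by omega)
  e_x := h.e_x
  x_x := h.x_x
  x_t k l _ _ := h.x_t k l (by omega) (by omega)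
  t_t k l _ h2 _ := h.t_t k l (by omega) h2 (by omega)
  sq k _ _ := h.sq k (by omega) (by omega)
  braid k _ _ := h.braid k (by omega) (by omega)
  dot_left k _ _ := h.dot_left k (by omega) (by omega)
  dot_right k _ _ := h.dot_right k (by omega) (by omega)

/-- Crossings slide through a descending product. -/
theorem desc_mul (h : Relations E t x p (n + 1)) (k : ℕ) (h1 : p ≤ k) (h2 : k + 1 < p + n) :
    desc t p n * t (k + 1) = t k * desc t p n := by
  induction n with
  | zero => omega
  | succ n ih =>
    by_cases hk : k + 1 = p + n
    -- This is the only case which uses the braid relation: `t (k + 1)` is the leftmost letter of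
    -- the word. Otherwise the leftmost letter is distant from `t k` and the induction hypothesis
    -- applies to the rest.
    · obtain ⟨n, rfl⟩ : ∃ l, n = l + 1 := ⟨n - 1, by omega⟩
      have hk' : k = p + n := by omega
      subst hk'
      have hc : Commute (t (p + n + 1)) (desc t p n) :=
        commute_desc fun l h3 h4 => (h.t_t l _ h3 (by omega) (by omega)).symm
      have hb := h.braid (p + n) (by omega) (by omega)
      rw [desc, desc, show p + (n + 1) = p + n + 1 by omega]
      calc _ = t (p + n + 1) * t (p + n) * (desc t p n * t (p + n + 1)) := by noncomm_ring
        _ = t (p + n + 1) * t (p + n) * t (p + n + 1) * desc t p n := by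
          rw [← hc.eq]; noncomm_ring
        _ = _ := by rw [← hb]; noncomm_ring
    · rw [desc, mul_assoc, ih (h.mono le_rfl (by omega)) (by omega), ← mul_assoc, ← mul_assoc,
        (h.t_t k (p + n) h1 (by omega) (by omega)).eq]

theorem mul_asc (h : Relations E t x p (n + 1)) (k : ℕ) (h1 : p ≤ k) (h2 : k + 1 < p + n) :
    t (k + 1) * asc t p n = asc t p n * t k := by
  induction n with
  | zero => omega
  | succ n ih =>
    by_cases hk : k + 1 = p + n
    · obtain ⟨n, rfl⟩ : ∃ l, n = l + 1 := ⟨n - 1, by omega⟩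
      have hk' : k = p + n := by omega
      subst hk'
      have hc : Commute (t (p + n + 1)) (asc t p n) :=
        commute_asc fun l h3 h4 => (h.t_t l _ h3 (by omega) (by omega)).symm
      have hb := h.braid (p + n) (by omega) (by omega)
      rw [asc, asc, show p + (n + 1) = p + n + 1 by omega]
      calc _ = (t (p + n + 1) * asc t p n) * t (p + n) * t (p + n + 1) := by noncomm_ring
        _ = asc t p n * (t (p + n + 1) * t (p + n) * t (p + n + 1)) := by
          rw [hc.eq]; noncomm_ring
        _ = _ := by rw [← hb]; noncomm_ring
    · rw [asc, ← mul_assoc, ih (h.mono le_rfl (by omega)) (by omega), mul_assoc, mul_assoc,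
        (h.t_t k (p + n) h1 (by omega) (by omega)).eq]

/-- The word `desc t p n` is a single strand crossing `n` others, and anything drawn with those
others slides through it, with positions shifted by one. Letting a whole half twist slide gives
further factorizations of the longest word. -/
theorem long_mul_desc {l : ℕ} (h : Relations E t x p (n + 1)) (hl : l ≤ n) :
    long t p l * desc t p n = desc t p n * long t (p + 1) l := by
  have hd : ∀ l, l + 1 ≤ n → desc t p l * desc t p n = desc t p n * desc t (p + 1) l := by
    intro l hl
    induction l with
    | zero => simp [desc]
    | succ l ih =>
      have := h.desc_mul (p + l) (by omega) (by omega)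
      rw [desc, mul_assoc, ih (by omega), ← mul_assoc, ← this, desc, mul_assoc,
        show p + l + 1 = p + 1 + l by omega]
  induction l with
  | zero => simp [long]
  | succ l ih =>
    rw [long, mul_assoc, hd l hl, ← mul_assoc, ih (by omega), mul_assoc, long]

theorem long_mul_asc {l : ℕ} (h : Relations E t x p (n + 1)) (hl : l ≤ n) :
    long t (p + 1) l * asc t p n = asc t p n * long t p l := by
  have hd : ∀ l, l + 1 ≤ n → desc t (p + 1) l * asc t p n = asc t p n * desc t p l := by
    intro l hl
    induction l with
    | zero => simp [desc]
    | succ l ih =>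
      have := h.mul_asc (p + l) (by omega) (by omega)
      rw [desc, mul_assoc, ih (by omega), ← mul_assoc, show p + 1 + l = p + l + 1 by omega,
        this, desc, mul_assoc]
  induction l with
  | zero => simp [long]
  | succ l ih =>
    rw [long, mul_assoc, hd l hl, ← mul_assoc, ih (by omega), mul_assoc, long]

theorem desc_mul_long (h : Relations E t x p (n + 1)) :
    desc t p n * long t (p + 1) n = long t p (n + 1) :=
  (h.long_mul_desc le_rfl).symm

theorem asc_mul_long (h : Relations E t x p (n + 1)) :
    asc t p n * long t p n = long t p (n + 1) :=
  (long_succ_eq_asc_mul fun k l h1 h2 h3 => h.t_t k l h1 h2 (by omega)).symm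

theorem long_mul_asc_self (h : Relations E t x p (n + 1)) :
    long t (p + 1) n * asc t p n = long t p (n + 1) :=
  (h.long_mul_asc le_rfl).trans h.asc_mul_long

/-- A longest word can be rewritten to begin with any given crossing, whose square is zero. -/
theorem mul_long (h : Relations E t x p n) (k : ℕ) (h1 : p ≤ k) (h2 : k + 1 < p + n) :
    t k * long t p n = 0 := by
  induction n generalizing k with
  | zero => omega
  | succ n ih =>
    by_cases hk : k = p
    · subst hk
      obtain ⟨n, rfl⟩ : ∃ l, n = l + 1 := ⟨n - 1, by omega⟩
      rw [← h.asc_mul_long, asc_succ', ← mul_assoc, ← mul_assoc, h.sq _ le_rfl (by omega),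
        zero_mul, zero_mul]
    · obtain ⟨k, rfl⟩ : ∃ l, k = l + 1 := ⟨k - 1, by omega⟩
      rw [← h.asc_mul_long, ← mul_assoc, h.mul_asc k (by omega) (by omega), mul_assoc,
        ih (h.mono le_rfl (by omega)) k (by omega) (by omega), mul_zero]

/-- On an element `z` killed by `t k`, the map f ↦ `t k` f z is f ↦ ∂_k(f) z with ∂_k the Demazure
operator; here f is a power of one variable. -/
theorem t_mul_pow_left (h : Relations E t x p n) {k : ℕ} (h1 : p ≤ k) (h2 : k + 1 < p + n)
    {z : R} (hz : t k * z = 0) (hE : E * z = z) (c : ℕ) :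
    t k * (x k ^ c * z) = ∑ i ∈ Finset.range c, x (k + 1) ^ i * (x k ^ (c - 1 - i) * z) := by
  induction c with
  | zero => simp [hz]
  | succ c ih =>
    have h3 : E * (x k ^ c * z) = x k ^ c * z := by
      rw [← mul_assoc, ((h.e_x k).pow_right c).eq, mul_assoc, hE]
    rw [pow_succ', mul_assoc, ← mul_assoc, h.dot_left k h1 h2, add_mul, mul_assoc, ih, h3,
      Finset.mul_sum, Finset.sum_range_succ']
    simp only [pow_succ', mul_assoc, Nat.sub_sub, pow_zero, one_mul, Nat.sub_zero,
      Nat.add_sub_cancel]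
    congr 1
    exact Finset.sum_congr rfl fun i _ => by rw [add_comm 1 i]

theorem t_mul_pow_right (h : Relations E t x p n) {k : ℕ} (h1 : p ≤ k) (h2 : k + 1 < p + n)
    {z : R} (hz : t k * z = 0) (hE : E * z = z) (c : ℕ) :
    t k * (x (k + 1) ^ c * z) =
      -∑ i ∈ Finset.range c, x k ^ i * (x (k + 1) ^ (c - 1 - i) * z) := by
  induction c with
  | zero => simp [hz]
  | succ c ih =>
    have h3 : E * (x (k + 1) ^ c * z) = x (k + 1) ^ c * z := by
      rw [← mul_assoc, ((h.e_x (k + 1)).pow_right c).eq, mul_assoc, hE]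
    rw [pow_succ', mul_assoc, ← mul_assoc, h.dot_right k h1 h2, sub_mul, mul_assoc, ih, h3,
      mul_neg, Finset.mul_sum, Finset.sum_range_succ', neg_add, sub_eq_add_neg]
    simp only [pow_succ', mul_assoc, Nat.sub_sub, pow_zero, one_mul, Nat.sub_zero,
      Nat.add_sub_cancel]
    congr 2
    exact Finset.sum_congr rfl fun i _ => by rw [add_comm 1 i]

/-- The iterated Demazure operators on powers of the first variable. -/
theorem desc_mul_pow (h : Relations E t x p (n + 1)) {z : R}
    (hz : ∀ k, p ≤ k → k < p + n → t k * z = 0) (hE : E * z = z) (c : ℕ) (hc : c ≤ n) :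
    desc t p n * (x p ^ c * z) = if c = n then z else 0 := by
  induction n generalizing p c z with
  | zero => obtain rfl : c = 0 := by omega
            simp [desc]
  | succ n ih =>
    -- The induction hypothesis is used for `x p ^ d * z` in place of `z`: the crossings from `p +
    -- 1` on commute with `x p` and so kill this element too.
    have hi : ∀ i d, i ≤ n → desc t (p + 1) n * (x (p + 1) ^ i * (x p ^ d * z)) =
        if i = n then x p ^ d * z else 0 := by
      intro i d hin
      refine ih (h.mono (q := p + 1) (by omega) (by omega)) (fun k h1 h2 => ?_) ?_ i hin
      · rw [← mul_assoc, ← ((h.x_t k p (by omega) (by omega) (by omega) (by omega)).pow_left d).eq,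
          mul_assoc, hz k (by omega) (by omega), mul_zero]
      · rw [← mul_assoc, ((h.e_x p).pow_right d).eq, mul_assoc, hE]
    rw [desc_succ', mul_assoc, h.t_mul_pow_left le_rfl (by omega) (hz p le_rfl (by omega)) hE,
      Finset.mul_sum]
    -- In the sum, i < c ≤ n + 1, and only i = n contributes. This index occurs exactly when c = n +
    -- 1, and then no power of `x p` is left over.
    split_ifs with hcn
    · subst hcn
      rw [Finset.sum_range_succ, hi n _ le_rfl, Finset.sum_eq_zero]
      · simp
      · intro i hi'
        rw [Finset.mem_range] at hi'
        rw [hi i _ hi'.le, if_neg (by omega)]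
    · refine Finset.sum_eq_zero fun i hi' => ?_
      rw [Finset.mem_range] at hi'
      rw [hi i _ (by omega), if_neg (by omega)]

/-- The iterated Demazure operators on powers of the last variable. -/
theorem asc_mul_pow (h : Relations E t x p (n + 1)) {z : R}
    (hz : ∀ k, p ≤ k → k < p + n → t k * z = 0) (hE : E * z = z) (c : ℕ) (hc : c ≤ n) :
    asc t p n * (x (p + n) ^ c * z) = if c = n then (-1) ^ n * z else 0 := by
  induction n generalizing c with
  | zero => obtain rfl : c = 0 := by omega
            simp [asc]
  | succ n ih =>
    have hi : ∀ i d, i ≤ n → asc t p n * (x (p + n) ^ i * (x (p + n + 1) ^ d * z)) =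
        x (p + n + 1) ^ d * if i = n then (-1) ^ n * z else 0 := by
      intro i d hin
      have hc : Commute (x (p + n + 1) ^ d) (asc t p n) := commute_asc fun k h1 h2 =>
        (h.x_t k _ h1 (by omega) (by omega) (by omega)).pow_left d
      rw [← ih (h.mono le_rfl (by omega)) (fun k h1 h2 => hz k h1 (by omega)) i hin,
        ← mul_assoc (x (p + n) ^ i), ((h.x_x (p + n) (p + n + 1)).pow_pow i d).eq,
        ← mul_assoc (x (p + n + 1) ^ d) (asc t p n), hc.eq]
      noncomm_ring
    rw [asc, mul_assoc, show p + (n + 1) = p + n + 1 by omega,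
      h.t_mul_pow_right (by omega) (by omega) (hz _ (by omega) (by omega)) hE, mul_neg,
      Finset.mul_sum]
    split_ifs with hcn
    · subst hcn
      rw [Finset.sum_range_succ, hi n _ le_rfl, Finset.sum_eq_zero]
      · simp [pow_succ]
      · intro i hi'
        rw [Finset.mem_range] at hi'
        rw [hi i _ hi'.le, if_neg (by omega), mul_zero]
    · rw [Finset.sum_eq_zero, neg_zero]
      intro i hi'
      rw [Finset.mem_range] at hi'
      rw [hi i _ (by omega), if_neg (by omega), mul_zero]

/-- The staircase is the monomial which the longest Demazure operator sends to 1, so `long * stair`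
is an idempotent. In the induction the first half twist is split as `desc * long` and the second as
`long * asc`: the inner staircase collapses by induction, and `desc` then sends the remaining power
of `x p` to 1. -/
theorem long_stair_long (h : Relations E t x p n) :
    long t p n * stair x p n * (long t p n * E) = long t p n * E := by
  induction n generalizing p with
  | zero => simp [long, stair]
  | succ n ih =>
    have hx : Commute (x p ^ n) (long t (p + 1) n) := commute_long fun k h1 h2 =>
      (h.x_t k p (by omega) (by omega) (by omega) (by omega)).pow_left n
    have hE : Commute E (asc t p n) := commute_asc fun k h1 h2 => by
      rw [Commute, SemiconjBy, h.e_t k h1 (by omega), h.t_e k h1 (by omega)]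
    have hE' : Commute E (long t p (n + 1)) := commute_long fun k h1 h2 => by
      rw [Commute, SemiconjBy, h.e_t k h1 (by omega), h.t_e k h1 (by omega)]
    have hi := ih (h.mono (q := p + 1) (l := n) (by omega) (by omega))
    calc _ = desc t p n * (long t (p + 1) n * x p ^ n) * stair x (p + 1) n *
          (long t (p + 1) n * (asc t p n * E)) := by
          rw [stair, ← mul_assoc (long t (p + 1) n) (asc t p n), h.long_mul_asc_self,
            ← h.desc_mul_long]
          noncomm_ring
      _ = desc t p n * x p ^ n * (long t (p + 1) n * stair x (p + 1) n *
          (long t (p + 1) n * E)) * asc t p n := by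
          rw [← hx.eq, ← hE.eq]; noncomm_ring
      _ = desc t p n * (x p ^ n * (long t p (n + 1) * E)) := by
          rw [hi, ← h.long_mul_asc_self, mul_assoc _ (asc t p n), ← hE.eq]; noncomm_ring
      _ = _ := by
          rw [h.desc_mul_pow (fun k h1 h2 => by
              rw [← mul_assoc, h.mul_long k h1 (by omega), zero_mul])
            (by rw [← mul_assoc, hE'.eq, mul_assoc, h.idem]) n le_rfl, if_pos rfl]

end Relations

end NilHecke

/-! ### The local relations on the sequences i^a j i^{m-a} -/

namespace NilHecke

/-- The relations between the crossings `T`, the dots `X` and the idempotents `E a` of the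
sequences `i^a j i^{m-a}`, in which the colour `j` has position `a`. -/
structure SerreRelations {R : Type*} [Ring R] (T X E : ℕ → R) (m q : ℕ) : Prop where
  e_e : ∀ a ≤ m, E a * E a = E a
  e_x : ∀ a k, Commute (E a) (X k)
  e_t : ∀ a k, k + 1 < a ∧ a ≤ m ∨ a < k ∧ k < m → Commute (E a) (T k)
  e_t_self : ∀ a < m, E a * T a = T a * E (a + 1)
  e_succ_t : ∀ a < m, E (a + 1) * T a = T a * E a
  x_x : ∀ k l, Commute (X k) (X l)
  x_t : ∀ k l, l ≠ k → l ≠ k + 1 → Commute (X l) (T k)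
  t_t : ∀ k l, k + 1 < l → Commute (T k) (T l)
  sq : ∀ a k, k + 1 < a ∧ a ≤ m ∨ a < k ∧ k < m → T k * T k * E a = 0
  dot_left : ∀ a k, k + 1 < a ∧ a ≤ m ∨ a < k ∧ k < m →
    T k * X k * E a = X (k + 1) * T k * E a + E a
  dot_right : ∀ a k, k + 1 < a ∧ a ≤ m ∨ a < k ∧ k < m →
    T k * X (k + 1) * E a = X k * T k * E a - E a
  braid : ∀ a k, a ≤ m → k + 1 < m → a ≠ k + 1 →
    T k * T (k + 1) * T k * E a = T (k + 1) * T k * T (k + 1) * E a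
  braid_mid : ∀ a, a + 1 < m →
    T (a + 1) * T a * T (a + 1) * E (a + 1) = T a * T (a + 1) * T a * E (a + 1) -
      ∑ c ∈ Finset.range (m - 1), X a ^ c * X (a + 2) ^ (m - 2 - c) * E (a + 1)
  sq_first : 1 < m → T 0 * T 0 * E 0 = X 0 ^ q * E 0 + X 1 ^ (m - 1) * E 0
  sq_last : 1 < m →
    T (m - 1) * T (m - 1) * E m = X (m - 1) ^ (m - 1) * E m + X m ^ q * E m
  sq_first_one : m = 1 → T 0 * T 0 * E 0 = E 0
  sq_last_one : m = 1 → T 0 * T 0 * E 1 = E 1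

namespace SerreRelations

variable {R : Type*} [Ring R] {T X E : ℕ → R} {m q : ℕ} {a b p n k : ℕ} {z : R}

/-- The hypothesis places the strands `p, …, p + n - 1` entirely on one side of the strand of colour
`j`, where all colours equal `i`. -/
theorem relations (S : SerreRelations T X E m q)
    (h : p + n ≤ a ∧ a ≤ m ∨ a < p ∧ p + n ≤ m + 1 ∧ a ≤ m) :
    Relations (E a) (fun k => T k * E a) X p n := by
  have hk : ∀ k, p ≤ k → k + 1 < p + n → k + 1 < a ∧ a ≤ m ∨ a < k ∧ k < m := by omega
  have he : E a * E a = E a := S.e_e a (by omega)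
  have hc : ∀ k, p ≤ k → k + 1 < p + n → E a * T k = T k * E a := fun k h1 h2 =>
    (S.e_t a k (hk k h1 h2)).eq
  have hc' : ∀ k, p ≤ k → k + 1 < p + n → ∀ z, E a * (T k * z) = T k * (E a * z) :=
    fun k h1 h2 z => by rw [← mul_assoc, hc k h1 h2, mul_assoc]
  have he' : ∀ z, E a * (E a * z) = E a * z := fun z => by rw [← mul_assoc, he]
  refine ⟨he, fun k h1 h2 => ?_, fun k h1 h2 => ?_, S.e_x a, S.x_x,
    fun k l h1 h2 h3 h4 => (S.x_t k l h3 h4).mul_right (S.e_x a l).symm, fun k l h1 h2 h3 => ?_,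
    fun k h1 h2 => ?_, fun k h1 h2 => ?_, fun k h1 h2 => ?_, fun k h1 h2 => ?_⟩
  · simp only [hc' k h1 h2, he]
  · simp only [mul_assoc, he]
  · have := (S.t_t k l h2).eq
    simp only [Commute, SemiconjBy, mul_assoc, hc' k h1 (by omega), hc' l (by omega) (by omega),
      he]
    rw [← mul_assoc, this, mul_assoc]
  · simp only [mul_assoc, hc' k h1 h2, he]
    rw [← mul_assoc, S.sq a k (hk k h1 h2)]
  · have := S.braid a k (by omega) (by omega) (by omega)
    simp only [mul_assoc, hc' k h1 (by omega), hc' (k + 1) (by omega) (by omega), he]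
      at this ⊢
    exact this
  · have := S.dot_left a k (hk k h1 h2)
    rw [mul_assoc, (S.e_x a k).eq, ← mul_assoc, this, mul_assoc]
  · have := S.dot_right a k (hk k h1 h2)
    rw [mul_assoc, (S.e_x a (k + 1)).eq, ← mul_assoc, this, mul_assoc]

section Fixed

/-- The relations depend on the sequence at the bottom of a diagram. In what follows this sequence
is recorded by an equation `E a * z = z`, and the lemmas of this kind update it when letters are
multiplied on the left of `z`. -/
theorem e_mul_t (S : SerreRelations T X E m q)
    (h : k + 1 < a ∧ a ≤ m ∨ a < k ∧ k < m) (hz : E a * z = z) :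
    E a * (T k * z) = T k * z := by
  rw [← mul_assoc, (S.e_t a k h).eq, mul_assoc, hz]

theorem e_mul_t_self (S : SerreRelations T X E m q)
    (h : a < m) (hz : E (a + 1) * z = z) : E a * (T a * z) = T a * z := by
  rw [← mul_assoc, S.e_t_self a h, mul_assoc, hz]

theorem e_mul_succ_t (S : SerreRelations T X E m q)
    (h : a < m) (hz : E a * z = z) : E (a + 1) * (T a * z) = T a * z := by
  rw [← mul_assoc, S.e_succ_t a h, mul_assoc, hz]

theorem e_mul_pow (S : SerreRelations T X E m q)
    (c : ℕ) (hz : E a * z = z) : E a * (X k ^ c * z) = X k ^ c * z := by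
  rw [← mul_assoc, ((S.e_x a k).pow_right c).eq, mul_assoc, hz]

theorem e_mul_stair (S : SerreRelations T X E m q)
    (hz : E a * z = z) : E a * (stair X p n * z) = stair X p n * z := by
  rw [← mul_assoc, (commute_stair fun k _ _ => S.e_x a k).eq, mul_assoc, hz]

/-- The bounds here differ by one from those for `desc` and `asc`: `long T p n` moves `n` strands,
whereas `desc T p n` and `asc T p n` move `n + 1`. -/
theorem commute_e_long (S : SerreRelations T X E m q)
    (h : p + n ≤ a ∧ a ≤ m ∨ a < p ∧ p + n ≤ m + 1) :
    Commute (E a) (long T p n) :=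
  commute_long fun k _ _ => S.e_t a k (by omega)

theorem commute_e_desc (S : SerreRelations T X E m q) (h : p + n < a ∧ a ≤ m ∨ a < p ∧ p + n ≤ m) :
    Commute (E a) (desc T p n) :=
  commute_desc fun k _ _ => S.e_t a k (by omega)

theorem commute_e_asc (S : SerreRelations T X E m q) (h : p + n < a ∧ a ≤ m ∨ a < p ∧ p + n ≤ m) :
    Commute (E a) (asc T p n) :=
  commute_asc fun k _ _ => S.e_t a k (by omega)

theorem e_mul_long (S : SerreRelations T X E m q)
    (h : p + n ≤ a ∧ a ≤ m ∨ a < p ∧ p + n ≤ m + 1) (hz : E a * z = z) :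
    E a * (long T p n * z) = long T p n * z := by
  rw [← mul_assoc, (S.commute_e_long h).eq, mul_assoc, hz]

theorem e_mul_desc (S : SerreRelations T X E m q)
    (h : p + n < a ∧ a ≤ m ∨ a < p ∧ p + n ≤ m) (hz : E a * z = z) :
    E a * (desc T p n * z) = desc T p n * z := by
  rw [← mul_assoc, (S.commute_e_desc h).eq, mul_assoc, hz]

theorem e_mul_asc (S : SerreRelations T X E m q)
    (h : p + n < a ∧ a ≤ m ∨ a < p ∧ p + n ≤ m) (hz : E a * z = z) :
    E a * (asc T p n * z) = asc T p n * z := by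
  rw [← mul_assoc, (S.commute_e_asc h).eq, mul_assoc, hz]

theorem long_eq (S : SerreRelations T X E m q)
    (h : p + n ≤ a ∧ a ≤ m ∨ a < p ∧ p + n ≤ m + 1 ∧ a ≤ m) (hz : E a * z = z) :
    long (fun k => T k * E a) p n * z = long T p n * z := by
  rw [← hz, ← mul_assoc, long_mul_of_commute (S.e_e a (by omega)) (fun _ _ _ => rfl)
    (fun k _ _ => S.e_t a k (by omega)), mul_assoc]

theorem desc_eq (S : SerreRelations T X E m q)
    (h : p + n < a ∧ a ≤ m ∨ a < p ∧ p + n ≤ m) (hz : E a * z = z) :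
    desc (fun k => T k * E a) p n * z = desc T p n * z := by
  rw [← hz, ← mul_assoc, desc_mul_of_commute (S.e_e a (by omega)) (fun _ _ _ => rfl)
    (fun k _ _ => S.e_t a k (by omega)), mul_assoc]

theorem asc_eq (S : SerreRelations T X E m q)
    (h : p + n < a ∧ a ≤ m ∨ a < p ∧ p + n ≤ m) (hz : E a * z = z) :
    asc (fun k => T k * E a) p n * z = asc T p n * z := by
  rw [← hz, ← mul_assoc, asc_mul_of_commute (S.e_e a (by omega)) (fun _ _ _ => rfl)
    (fun k _ _ => S.e_t a k (by omega)), mul_assoc]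

theorem desc_mul_long (S : SerreRelations T X E m q)
    (h : p + n < a ∧ a ≤ m ∨ a < p ∧ p + n ≤ m) (hz : E a * z = z) :
    desc T p n * (long T (p + 1) n * z) = long T p (n + 1) * z := by
  rw [← S.long_eq (p := p) (n := n + 1) (by omega) hz,
    ← S.desc_eq h (S.e_mul_long (by omega) hz), ← S.long_eq (p := p + 1) (by omega) hz,
    ← mul_assoc, (S.relations (p := p) (n := n + 1) (by omega)).desc_mul_long]

theorem long_mul_asc (S : SerreRelations T X E m q)
    (h : p + n < a ∧ a ≤ m ∨ a < p ∧ p + n ≤ m) (hz : E a * z = z) :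
    long T (p + 1) n * (asc T p n * z) = long T p (n + 1) * z := by
  rw [← S.long_eq (p := p) (n := n + 1) (by omega) hz,
    ← S.long_eq (by omega) (S.e_mul_asc h hz), ← S.asc_eq h hz,
    ← mul_assoc, (S.relations (p := p) (n := n + 1) (by omega)).long_mul_asc_self]

/-- No idempotent enters, since this factorization rests on distant commutation alone. -/
theorem asc_mul_long (S : SerreRelations T X E m q)
    : asc T p n * (long T p n * z) = long T p (n + 1) * z := by
  rw [← mul_assoc, long_succ_eq_asc_mul fun k l _ h _ => S.t_t k l h]

theorem t_mul_long (S : SerreRelations T X E m q)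
    (h : p + n ≤ a ∧ a ≤ m ∨ a < p ∧ p + n ≤ m + 1 ∧ a ≤ m)
    (h1 : p ≤ k) (h2 : k + 1 < p + n) (hz : E a * z = z) : T k * (long T p n * z) = 0 := by
  have h3 := (S.relations h).mul_long k h1 h2
  rw [← S.e_mul_long (by omega) hz, ← S.long_eq h hz, ← mul_assoc, ← mul_assoc, h3, zero_mul]

theorem long_stair_long (S : SerreRelations T X E m q)
    (h : p + n ≤ a ∧ a ≤ m ∨ a < p ∧ p + n ≤ m + 1 ∧ a ≤ m)
    (hz : E a * z = z) :
    long T p n * (stair X p n * (long T p n * z)) = long T p n * z := by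
  have h3 := (S.relations h).long_stair_long
  rw [← S.long_eq h (S.e_mul_stair (S.e_mul_long (by omega) hz)), ← S.long_eq h hz, ← mul_assoc]
  conv_lhs => rw [← hz, ← mul_assoc (long _ _ _), ← mul_assoc, h3, mul_assoc, hz]

theorem desc_mul_pow (S : SerreRelations T X E m q) (h : p + n < a ∧ a ≤ m ∨ a < p ∧ p + n ≤ m)
    (h0 : ∀ k, p ≤ k → k < p + n → T k * z = 0) (hz : E a * z = z) (c : ℕ) (hc : c ≤ n) :
    desc T p n * (X p ^ c * z) = if c = n then z else 0 := by
  rw [← S.desc_eq h (S.e_mul_pow c hz)]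
  exact (S.relations (p := p) (n := n + 1) (by omega)).desc_mul_pow
    (fun k h1 h2 => by rw [mul_assoc, hz, h0 k h1 h2]) hz c hc

theorem asc_mul_pow (S : SerreRelations T X E m q) (h : p + n < a ∧ a ≤ m ∨ a < p ∧ p + n ≤ m)
    (h0 : ∀ k, p ≤ k → k < p + n → T k * z = 0) (hz : E a * z = z) (c : ℕ) (hc : c ≤ n) :
    asc T p n * (X (p + n) ^ c * z) = if c = n then (-1) ^ n * z else 0 := by
  rw [← S.asc_eq h (S.e_mul_pow c hz)]
  exact (S.relations (p := p) (n := n + 1) (by omega)).asc_mul_pow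
    (fun k h1 h2 => by rw [mul_assoc, hz, h0 k h1 h2]) hz c hc

theorem t_commute_long (S : SerreRelations T X E m q)
    (h : k + 1 < p ∨ p + n ≤ k) : Commute (T k) (long T p n) :=
  commute_long fun l h1 h2 => by
    rcases h with h | h
    · exact S.t_t k l (by omega)
    · exact (S.t_t l k (by omega)).symm

theorem t_commute_desc (S : SerreRelations T X E m q)
    (h : k + 1 < p ∨ p + n < k) : Commute (T k) (desc T p n) :=
  commute_desc fun l h1 h2 => by
    rcases h with h | h
    · exact S.t_t k l (by omega)
    · exact (S.t_t l k (by omega)).symm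

theorem t_commute_asc (S : SerreRelations T X E m q)
    (h : k + 1 < p ∨ p + n < k) : Commute (T k) (asc T p n) :=
  commute_asc fun l h1 h2 => by
    rcases h with h | h
    · exact S.t_t k l (by omega)
    · exact (S.t_t l k (by omega)).symm

theorem t_commute_stair (S : SerreRelations T X E m q)
    (h : k + 1 < p ∨ p + n ≤ k) : Commute (T k) (stair X p n) :=
  commute_stair fun l h1 h2 => (S.x_t k l (by omega) (by omega)).symm

theorem x_commute_desc (S : SerreRelations T X E m q)
    (h : k < p ∨ p + n < k) : Commute (X k) (desc T p n) :=
  commute_desc fun l h1 h2 => S.x_t l k (by omega) (by omega)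

theorem x_commute_asc (S : SerreRelations T X E m q)
    (h : k < p ∨ p + n < k) : Commute (X k) (asc T p n) :=
  commute_asc fun l h1 h2 => S.x_t l k (by omega) (by omega)

theorem stair_commute_stair (S : SerreRelations T X E m q)
    (a b p n : ℕ) : Commute (stair X a b) (stair X p n) :=
  commute_stair fun k _ _ => (commute_stair fun l _ _ => S.x_x k l).symm

theorem long_commute_long (S : SerreRelations T X E m q)
    {c : ℕ} (h : c ≤ p) : Commute (long T 0 c) (long T p n) :=
  commute_long fun k _ _ => (S.t_commute_long (by omega)).symm

theorem stair_commute_long (S : SerreRelations T X E m q) {c l : ℕ} (h : c + l ≤ p ∨ p + n ≤ c) :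
    Commute (stair X c l) (long T p n) :=
  commute_long fun k _ _ => (S.t_commute_stair (by omega)).symm

end Fixed

end SerreRelations
end NilHecke

/-! ### Moving a strand of colour i from one thick strand to the other -/

namespace NilHecke

/-- The two thick strands around the strand of colour `j` in `i^(a) j i^(b)`. -/
def blocks {R : Type*} [Ring R] (T X : ℕ → R) (a b : ℕ) : R :=
  long T 0 a * stair X 0 a * (long T (a + 1) b * stair X (a + 1) b)

namespace SerreRelations

variable {R : Type*} [Ring R] {T X E : ℕ → R} {m q : ℕ} {a b : ℕ} {z : R}

theorem e_mul_blocks (S : SerreRelations T X E m q) (h : a + b = m) (hz : E a * z = z) :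
    E a * (blocks T X a b * z) = blocks T X a b * z := by
  simp only [blocks, mul_assoc]
  exact S.e_mul_long (by omega) (S.e_mul_stair (S.e_mul_long (by omega) (S.e_mul_stair hz)))

/-- With all crossings to the left of all dots, letters multiplied from the left meet the two half
twists directly. -/
theorem blocks_mul (S : SerreRelations T X E m q)
    (a b : ℕ) (z : R) : blocks T X a b * z = long T 0 a * (long T (a + 1) b *
    (stair X 0 a * (stair X (a + 1) b * z))) := by
  simp only [blocks, mul_assoc]
  rw [(S.stair_commute_long (c := 0) (l := a) (p := a + 1) (n := b) (by omega)).left_comm]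

theorem blocks_idem (S : SerreRelations T X E m q) (h : a + b = m) (hz : E a * z = z) :
    blocks T X a b * (blocks T X a b * z) = blocks T X a b * z := by
  have h1 := S.e_mul_stair (p := 0) (n := a) (S.e_mul_stair (p := a + 1) (n := b) hz)
  have h2 := S.e_mul_long (p := a + 1) (n := b) (by omega) h1
  rw [S.blocks_mul a b z]
  simp only [blocks, mul_assoc]
  have c1 : Commute (stair X (a + 1) b) (long T 0 a) := S.stair_commute_long (by omega)
  have c2 : Commute (long T 0 a) (long T (a + 1) b) := S.long_commute_long (by omega)
  rw [c1.left_comm, ← c2.left_comm, S.long_stair_long (by omega) h1,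
    S.long_stair_long (by omega) h2]

/-- This supplies the hypothesis under which crossings act by Demazure operators, as in
`desc_mul_pow` and `asc_mul_pow`. -/
theorem t_mul_blocks (S : SerreRelations T X E m q) (h : a + b = m) (hz : E a * z = z) {k : ℕ}
    (hk : k + 1 < a ∨ a < k ∧ k < m) : T k * (blocks T X a b * z) = 0 := by
  have h1 := S.e_mul_stair (p := 0) (n := a) (S.e_mul_stair (p := a + 1) (n := b) hz)
  rw [S.blocks_mul]
  rcases hk with hk | hk
  · exact S.t_mul_long (by omega) (by omega) (by omega) (S.e_mul_long (by omega) h1)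
  · rw [(S.long_commute_long (c := a) (p := a + 1) (n := b) (by omega)).left_comm]
    exact S.t_mul_long (by omega) (by omega) (by omega) (S.e_mul_long (by omega) h1)

/-- The moving strand crosses `j` by `T a` and then runs through the right block, where `desc` and
the half twist merge into a half twist on one more strand. This symmetric form has a half twist of
the target at the left end. -/
theorem desc_mul_blocks (S : SerreRelations T X E m q)
    (h : a + (b + 1) = m) (hz : E (a + 1) * z = z) :
    desc T a (b + 1) * (blocks T X (a + 1) b * z) = long T (a + 1) (b + 1) *
      (T a * (long T 0 (a + 1) * (stair X 0 (a + 1) * (stair X (a + 2) b * z)))) := by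
  have h1 := S.e_mul_stair (p := 0) (n := a + 1) (S.e_mul_stair (p := a + 2) (n := b) hz)
  rw [S.blocks_mul, (S.long_commute_long (c := a + 1) (p := a + 1 + 1) (n := b)
    (by omega)).left_comm, desc_succ', mul_assoc,
    (S.t_commute_long (k := a) (p := a + 1 + 1) (n := b) (by omega)).left_comm]
  exact S.desc_mul_long (p := a + 1) (n := b) (a := a) (by omega)
    (S.e_mul_t_self (by omega) (S.e_mul_long (by omega) h1))

theorem asc_mul_blocks (S : SerreRelations T X E m q) (a b : ℕ) (z : R) :
    asc T 0 (a + 1) * (blocks T X a b * z) = long T 0 (a + 1) *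
      (T a * (long T (a + 1) b * (stair X 0 a * (stair X (a + 1) b * z)))) := by
  rw [S.blocks_mul, asc, mul_assoc, zero_add,
    (S.t_commute_long (k := a) (p := 0) (n := a) (by omega)).left_comm, S.asc_mul_long]

/-- Multiplication by the target idempotent changes nothing, because the product already begins with
its half twists: the right one is visible in `desc_mul_blocks`, and the left one is a prefix of
`long T 0 (a + 1)` which commutes past `T a`. Then `long * stair * long = long` applies on each
side. -/
theorem blocks_mul_desc (S : SerreRelations T X E m q)
    (h : a + (b + 1) = m) (hz : E (a + 1) * z = z) :
    blocks T X a (b + 1) * (desc T a (b + 1) * (blocks T X (a + 1) b * z)) =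
      desc T a (b + 1) * (blocks T X (a + 1) b * z) := by
  have h1 := S.e_mul_stair (p := 0) (n := a + 1) (S.e_mul_stair (p := a + 2) (n := b) hz)
  have h2 := S.e_mul_long (p := 0) (n := a + 1) (by omega) h1
  have h3 := S.e_mul_t_self (by omega) h2
  have c1 : Commute (stair X 0 a) (long T (a + 1) (b + 1)) := S.stair_commute_long (by omega)
  have c2 : Commute (long T 0 a) (long T (a + 1) (b + 1)) := S.long_commute_long (by omega)
  have c3 : Commute (T a) (stair X 0 a) := S.t_commute_stair (by omega)
  have c4 : Commute (T a) (long T 0 a) := S.t_commute_long (by omega)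
  have hd : E (a + 1) * (desc T 0 a * (stair X 0 (a + 1) * (stair X (a + 2) b * z))) = _ :=
    S.e_mul_desc (by omega) h1
  rw [S.desc_mul_blocks h hz]
  simp only [blocks, mul_assoc]
  rw [S.long_stair_long (by omega) h3, c1.left_comm, c2.left_comm, ← c3.left_comm,
    ← c4.left_comm, show long T 0 (a + 1) = long T 0 a * desc T 0 a from rfl, mul_assoc,
    S.long_stair_long (by omega) hd]

theorem blocks_mul_asc (S : SerreRelations T X E m q) (h : a + (b + 1) = m) (hz : E a * z = z) :
    blocks T X (a + 1) b * (asc T 0 (a + 1) * (blocks T X a (b + 1) * z)) =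
      asc T 0 (a + 1) * (blocks T X a (b + 1) * z) := by
  have h1 := S.e_mul_stair (p := 0) (n := a) (S.e_mul_stair (p := a + 1) (n := b + 1) hz)
  have h2 := S.e_mul_long (p := a + 1) (n := b + 1) (by omega) h1
  have h3 := S.e_mul_succ_t (by omega) h2
  have c1 : Commute (stair X (a + 2) b) (long T 0 (a + 1)) := S.stair_commute_long (by omega)
  have c2 : Commute (long T 0 (a + 1)) (long T (a + 2) b) := S.long_commute_long (by omega)
  have c3 : Commute (T a) (stair X (a + 2) b) := S.t_commute_stair (by omega)
  have c4 : Commute (T a) (long T (a + 2) b) := S.t_commute_long (by omega)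
  have hd : E a * (asc T (a + 1) b * (stair X 0 a * (stair X (a + 1) (b + 1) * z))) = _ :=
    S.e_mul_asc (by omega) h1
  -- The right block of the target has one strand fewer than that of the source; its half twist is
  -- split off from the larger one as a prefix and commuted past `T a`.
  have h4 : long T (a + 2) b * (stair X (a + 2) b * (T a * (long T (a + 1) (b + 1) *
      (stair X 0 a * (stair X (a + 1) (b + 1) * z))))) = T a * (long T (a + 1) (b + 1) *
      (stair X 0 a * (stair X (a + 1) (b + 1) * z))) := by
    rw [← c3.left_comm, ← c4.left_comm, ← S.long_mul_asc (by omega) h1,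
      S.long_stair_long (by omega) hd]
  rw [S.asc_mul_blocks]
  simp only [blocks, mul_assoc]
  rw [c1.left_comm, ← c2.left_comm, h4, S.long_stair_long (by omega) h3]

/-- Two strands leave the left block and cross `j` in turn. After merging, the product contains `T
(a + 1) * T a * T (a + 1)` on the colours i i j, where the braid relation has no error term; it
becomes a word ending in `T a`, which kills the left half twist. -/
theorem desc_mul_desc (S : SerreRelations T X E m q)
    (h : a + (b + 2) = m) (hz : E (a + 2) * z = z) :
    desc T a (b + 2) * (desc T (a + 1) (b + 1) * (blocks T X (a + 2) b * z)) = 0 := by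
  have h1 := S.e_mul_stair (p := 0) (n := a + 2) (S.e_mul_stair (p := a + 3) (n := b) hz)
  have h2 := S.e_mul_long (p := 0) (n := a + 2) (by omega) h1
  have h3 := S.e_mul_t_self (a := a) (by omega) (S.e_mul_t_self (a := a + 1) (by omega) h2)
  rw [S.desc_mul_blocks (a := a + 1) (by omega) hz, desc_succ', mul_assoc,
    (S.t_commute_long (k := a) (p := a + 1 + 1) (n := b + 1) (by omega)).left_comm,
    S.desc_mul_long (a := a) (by omega) h3, long, desc_succ']
  have hb := S.braid (a + 2) a (by omega) (by omega) (by omega)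
  have : T (a + 1) * (T a * (T (a + 1) * (long T 0 (a + 2) *
      (stair X 0 (a + 2) * (stair X (a + 3) b * z))))) = 0 := by
    rw [← h2]
    simp only [← mul_assoc]
    rw [← hb]
    simp only [mul_assoc]
    rw [h2, S.t_mul_long (by omega) (by omega) (by omega) h1, mul_zero, mul_zero]
  simp only [mul_assoc]
  rw [this, mul_zero, mul_zero]

theorem asc_mul_asc (S : SerreRelations T X E m q) (h : a + (b + 2) = m) (hz : E a * z = z) :
    asc T 0 (a + 2) * (asc T 0 (a + 1) * (blocks T X a (b + 2) * z)) = 0 := by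
  have h1 := S.e_mul_stair (p := 0) (n := a) (S.e_mul_stair (p := a + 1) (n := b + 2) hz)
  have h2 := S.e_mul_long (p := a + 1) (n := b + 2) (by omega) h1
  have h3 := S.e_mul_succ_t (a := a + 1) (by omega) (S.e_mul_succ_t (a := a) (by omega) h2)
  rw [S.asc_mul_blocks, asc, mul_assoc, zero_add,
    (S.t_commute_long (k := a + 1) (p := 0) (n := a + 1) (by omega)).left_comm,
    S.asc_mul_long, ← S.long_mul_asc (p := 0) (n := a + 1) (a := a + 2) (by omega) h3, asc]
  have hb := S.braid a a (by omega) (by omega) (by omega)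
  have : T a * (T (a + 1) * (T a * (long T (a + 1) (b + 2) *
      (stair X 0 a * (stair X (a + 1) (b + 2) * z))))) = 0 := by
    rw [← h2]
    simp only [← mul_assoc]
    rw [hb]
    simp only [mul_assoc]
    rw [h2, S.t_mul_long (by omega) (by omega) (by omega) h1, mul_zero, mul_zero]
  simp only [mul_assoc, zero_add]
  rw [this, mul_zero, mul_zero]

/-- Both products have the same outer words `desc T (a + 2) b` and `asc T 0 a` and differ only in
the two sides of the braid relation around `j`. The error term is evaluated by the Demazure formulas
on either side of `j`. -/
theorem desc_asc_sub_asc_desc (S : SerreRelations T X E m q)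
    (h : a + 1 + (b + 1) = m) (hz : E (a + 1) * z = z)
    (h0 : ∀ k, k + 1 < a + 1 ∨ a + 1 < k ∧ k < m → T k * z = 0) :
    desc T (a + 1) (b + 1) * (asc T 0 (a + 2) * z) - asc T 0 (a + 1) * (desc T a (b + 2) * z) =
      (-1) ^ (a + 1) * z := by
  have c1 : Commute (T (a + 1)) (asc T 0 a) := S.t_commute_asc (by omega)
  have c2 : Commute (T a) (desc T (a + 2) b) := S.t_commute_desc (by omega)
  have c3 : Commute (asc T 0 a) (desc T (a + 2) b) :=
    commute_desc fun k _ _ => (S.t_commute_asc (by omega)).symm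
  have hb := congrArg (· * z) (S.braid_mid a (by omega))
  simp only [sub_mul, Finset.sum_mul, mul_assoc, hz] at hb
  have e1 : desc T (a + 1) (b + 1) * (asc T 0 (a + 2) * z) =
      desc T (a + 2) b * (asc T 0 a * (T (a + 1) * (T a * (T (a + 1) * z)))) := by
    rw [desc_succ', asc, asc, mul_assoc, mul_assoc, mul_assoc, zero_add, c1.left_comm, zero_add]
  have e2 : asc T 0 (a + 1) * (desc T a (b + 2) * z) =
      desc T (a + 2) b * (asc T 0 a * (T a * (T (a + 1) * (T a * z)))) := by
    rw [desc_succ', desc_succ', asc, mul_assoc, mul_assoc, mul_assoc, zero_add, c2.left_comm,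
      c3.left_comm]
  rw [e1, e2, hb, mul_sub, mul_sub, sub_sub_cancel_left, Finset.mul_sum, Finset.mul_sum]
  have e3 : ∀ c d, asc T 0 a * (X a ^ c * (X (a + 2) ^ d * z)) =
      X (a + 2) ^ d * (asc T 0 a * (X a ^ c * z)) := fun c d => by
    rw [((S.x_x a (a + 2)).pow_pow c d).left_comm,
      ((S.x_commute_asc (k := a + 2) (p := 0) (n := a) (by omega)).pow_left d).left_comm]
  have e4 : ∀ c, c ≤ a → asc T 0 a * (X a ^ c * z) = if c = a then (-1) ^ a * z else 0 := by
    intro c hc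
    have := S.asc_mul_pow (p := 0) (n := a) (a := a + 1) (by omega)
      (fun k h1 h2 => h0 k (by omega)) hz c hc
    rwa [zero_add] at this
  have e5 : ∀ d, d ≤ b → desc T (a + 2) b * (X (a + 2) ^ d * z) = if d = b then z else 0 :=
    fun d hd => S.desc_mul_pow (p := a + 2) (n := b) (a := a + 1) (by omega)
      (fun k h1 h2 => h0 k (by omega)) hz d hd
  -- Here c + d = m - 2 = a + b. If c < a the left word gives zero; if c > a then d < b and the
  -- right word gives zero. The term c = a, d = b yields (-1)^a, and the sign of the error term
  -- raises the exponent to a + 1.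
  rw [Finset.sum_eq_single a]
  · rw [e3, e4 a le_rfl, if_pos rfl, show m - 2 - a = b by omega,
      ((Commute.neg_one_left (X (a + 2) ^ b)).pow_left a).symm.left_comm,
      ((Commute.neg_one_left (desc T (a + 2) b)).pow_left a).symm.left_comm, e5 b le_rfl,
      if_pos rfl, pow_succ]
    simp
  · intro c hc hca
    rw [Finset.mem_range] at hc
    rcases Nat.lt_or_gt_of_ne hca with hlt | hlt
    · rw [e3, e4 c hlt.le, if_neg hca, mul_zero, mul_zero]
    · rw [← c3.left_comm, ← ((S.x_commute_desc (k := a) (p := a + 2) (n := b)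
        (by omega)).pow_left c).left_comm, e5 _ (by omega), if_neg (by omega), mul_zero, mul_zero]
  · intro hc
    rw [Finset.mem_range] at hc
    omega

/-- With nothing to the left of `j`, the moving strand crosses it twice and the quadratic relation
applies. Of the two summands of τ², the power of the dot on `j` commutes with the remaining
crossings, which kill `z`; the power m - 1 of the dot on `i` is exactly what those m - 1 crossings
send to 1. -/
theorem desc_asc_first (S : SerreRelations T X E m q) (hm : 0 < m) (hz : E 0 * z = z)
    (h0 : ∀ k, 0 < k ∧ k < m → T k * z = 0) :
    desc T 0 m * (asc T 0 1 * z) = z := by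
  obtain ⟨n, rfl⟩ : ∃ n, m = n + 1 := ⟨m - 1, by omega⟩
  rw [desc_succ', asc, asc, zero_add, one_mul, zero_add, mul_assoc]
  -- For m = 1 the colours are orthogonal and τ² is the identity instead of a sum of two powers.
  rcases Nat.eq_zero_or_pos n with rfl | hn
  · have := congrArg (· * z) (S.sq_first_one rfl)
    simp only [mul_assoc, hz] at this
    rw [this, desc, one_mul]
  · have := congrArg (· * z) (S.sq_first (by omega))
    have h1 : ∀ d, d ≤ n → desc T 1 n * (X 1 ^ d * z) = if d = n then z else 0 :=
      fun d hd => S.desc_mul_pow (p := 1) (n := n) (a := 0) (by omega)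
        (fun k h1 h2 => h0 k (by omega)) hz d hd
    have h2 := h1 0 (by omega)
    rw [pow_zero, one_mul, if_neg (by omega)] at h2
    simp only [add_mul, mul_assoc, hz] at this
    rw [this, mul_add, ← ((S.x_commute_desc (k := 0) (p := 1) (n := n)
      (by omega)).pow_left q).left_comm, h2, mul_zero, zero_add, Nat.add_sub_cancel,
      h1 n le_rfl, if_pos rfl]

theorem asc_desc_last (S : SerreRelations T X E m q) (hm : 0 < m) (hz : E m * z = z)
    (h0 : ∀ k, k + 1 < m → T k * z = 0) :
    asc T 0 m * (desc T (m - 1) 1 * z) = -((-1) ^ m * z) := by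
  obtain ⟨n, rfl⟩ : ∃ n, m = n + 1 := ⟨m - 1, by omega⟩
  rw [asc, desc, desc, Nat.add_sub_cancel, add_zero, mul_one, zero_add, mul_assoc]
  rcases Nat.eq_zero_or_pos n with rfl | hn
  · have := congrArg (· * z) (S.sq_last_one rfl)
    rw [zero_add] at hz
    simp only [mul_assoc, hz] at this
    rw [this, asc, one_mul]
    simp
  · have := congrArg (· * z) (S.sq_last (by omega))
    have h1 : ∀ d, d ≤ n → asc T 0 n * (X n ^ d * z) = if d = n then (-1) ^ n * z else 0 := by
      intro d hd
      have := S.asc_mul_pow (p := 0) (n := n) (a := n + 1) (by omega)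
        (fun k h1 h2 => h0 k (by omega)) hz d hd
      rwa [zero_add] at this
    have h2 := h1 0 (by omega)
    rw [pow_zero, one_mul, if_neg (by omega)] at h2
    simp only [add_mul, mul_assoc, hz, Nat.add_sub_cancel] at this
    rw [this, mul_add, ← ((S.x_commute_asc (k := n + 1) (p := 0) (n := n)
      (by omega)).pow_left q).left_comm, h2, mul_zero, add_zero, h1 n le_rfl, if_pos rfl,
      pow_succ]
    simp

end SerreRelations
end NilHecke

/-! ### The defining relations of R(ν) for the summed generators -/

namespace BorcherdsCartanDatum

namespace KLR

open WSeq

variable {I : Type*} [Fintype I] [DecidableEq I] {D : BorcherdsCartanDatum I}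
  {K : Type*} [Field K] {ν : I → ℕ}

theorem mk_fe (s : WSeq ν) : RingQuot.mkAlgHom K (D.Rel K) (fe K s) = e D K s := rfl

theorem mk_fx (k : Fin (height ν)) (s : WSeq ν) :
    RingQuot.mkAlgHom K (D.Rel K) (fx K k s) = x D K k s := rfl

theorem mk_ftau (k : Fin (height ν - 1)) (s : WSeq ν) :
    RingQuot.mkAlgHom K (D.Rel K) (ftau K k s) = tau D K k s := rfl

theorem e_mul_self (s : WSeq ν) : e D K s * e D K s = e D K s := by
  simpa [mk_fe] using rel_eq (Rel.e_mul_self (D := D) (K := K) s)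

theorem e_mul_ne {s t : WSeq ν} (h : s ≠ t) : e D K s * e D K t = 0 := by
  simpa [mk_fe] using rel_eq (Rel.e_mul_ne (D := D) (K := K) s t h)

theorem sum_e : ∑ s : WSeq ν, e D K s = 1 := by
  simpa [mk_fe] using rel_eq (Rel.e_sum (D := D) (K := K) (ν := ν))

theorem e_mul_x (k : Fin (height ν)) (s : WSeq ν) : e D K s * x D K k s = x D K k s := by
  simpa [mk_fe, mk_fx] using rel_eq (Rel.e_x (D := D) (K := K) k s)

theorem x_mul_e (k : Fin (height ν)) (s : WSeq ν) : x D K k s * e D K s = x D K k s := by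
  simpa [mk_fe, mk_fx] using rel_eq (Rel.x_e (D := D) (K := K) k s)

theorem e_mul_tau (k : Fin (height ν - 1)) (s : WSeq ν) :
    e D K (sw k s) * tau D K k s = tau D K k s := by
  simpa [mk_fe, mk_ftau] using rel_eq (Rel.e_tau (D := D) (K := K) k s)

theorem tau_mul_e (k : Fin (height ν - 1)) (s : WSeq ν) :
    tau D K k s * e D K s = tau D K k s := by
  simpa [mk_fe, mk_ftau] using rel_eq (Rel.tau_e (D := D) (K := K) k s)

/-- Relations among the summed generators can thus be checked on one bottom sequence at a time. -/
theorem eq_of_mul_e {y z : D.KLR K ν} (h : ∀ s, y * e D K s = z * e D K s) : y = z := by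
  rw [← mul_one y, ← mul_one z, ← sum_e, Finset.mul_sum, Finset.mul_sum]
  exact Finset.sum_congr rfl fun s _ => h s

theorem X_mul_e {k : ℕ} (h : k < height ν) (s : WSeq ν) :
    X D K k * e D K s = x D K ⟨k, h⟩ s := by
  rw [X, dif_pos h, Finset.sum_mul, Finset.sum_eq_single s, x_mul_e]
  · intro t _ hts
    rw [← x_mul_e, mul_assoc, e_mul_ne hts, mul_zero]
  · simp

theorem e_mul_X {k : ℕ} (h : k < height ν) (s : WSeq ν) :
    e D K s * X D K k = x D K ⟨k, h⟩ s := by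
  rw [X, dif_pos h, Finset.mul_sum, Finset.sum_eq_single s, e_mul_x]
  · intro t _ hts
    rw [← e_mul_x, ← mul_assoc, e_mul_ne hts.symm, zero_mul]
  · simp

theorem commute_e_X (k : ℕ) (s : WSeq ν) : Commute (e D K s) (X D K k) := by
  by_cases h : k < height ν
  · rw [Commute, SemiconjBy, X_mul_e h, e_mul_X h]
  · rw [X, dif_neg h]
    exact Commute.zero_right _

theorem T_mul_e {k : ℕ} (h : k < height ν - 1) (s : WSeq ν) :
    T D K k * e D K s = tau D K ⟨k, h⟩ s := by
  rw [T, dif_pos h, Finset.sum_mul, Finset.sum_eq_single s, tau_mul_e]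
  · intro t _ hts
    rw [← tau_mul_e, mul_assoc, e_mul_ne hts, mul_zero]
  · simp

theorem e_mul_T {k : ℕ} (h : k < height ν - 1) (s : WSeq ν) :
    e D K (sw ⟨k, h⟩ s) * T D K k = T D K k * e D K s := by
  rw [T_mul_e h, T, dif_pos h, Finset.mul_sum, Finset.sum_eq_single s, e_mul_tau]
  · intro t _ hts
    rw [← e_mul_tau, ← mul_assoc, e_mul_ne, zero_mul]
    intro h'
    exact hts (by rw [← sw_sw ⟨k, h⟩ t, ← h', sw_sw])
  · simp

theorem X_mul_x {l : ℕ} (h : l < height ν) (k : Fin (height ν)) (s : WSeq ν) :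
    X D K l * x D K k s = x D K ⟨l, h⟩ s * x D K k s := by
  rw [← e_mul_x, ← mul_assoc, X_mul_e h, e_mul_x]

theorem T_mul_x {l : ℕ} (h : l < height ν - 1) (k : Fin (height ν)) (s : WSeq ν) :
    T D K l * x D K k s = tau D K ⟨l, h⟩ s * x D K k s := by
  rw [← e_mul_x, ← mul_assoc, T_mul_e h, e_mul_x]

theorem X_mul_tau {l : ℕ} (h : l < height ν) (k : Fin (height ν - 1)) (s : WSeq ν) :
    X D K l * tau D K k s = x D K ⟨l, h⟩ (sw k s) * tau D K k s := by
  rw [← e_mul_tau, ← mul_assoc, X_mul_e h, e_mul_tau]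

theorem T_mul_tau {l : ℕ} (h : l < height ν - 1) (k : Fin (height ν - 1)) (s : WSeq ν) :
    T D K l * tau D K k s = tau D K ⟨l, h⟩ (sw k s) * tau D K k s := by
  rw [← e_mul_tau, ← mul_assoc, T_mul_e h, e_mul_tau]

theorem X_pow_mul_e {k : ℕ} (h : k < height ν) (s : WSeq ν) (n : ℕ) :
    X D K k ^ n * e D K s = x D K ⟨k, h⟩ s ^ n * e D K s := by
  induction n with
  | zero => simp
  | succ n ih =>
    rw [pow_succ, mul_assoc, ← (commute_e_X k s).eq, ← mul_assoc, ih, mul_assoc, e_mul_X h,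
      pow_succ, mul_assoc, x_mul_e]

/-- The case n = 0 is excluded because that power is the unit of R(ν), not the idempotent of the
sequence. The same distinction explains the nonzero exponents required in `T_sq_of_ne`. -/
theorem x_pow_mul_e {k : Fin (height ν)} (s : WSeq ν) {n : ℕ} (hn : n ≠ 0) :
    x D K k s ^ n * e D K s = x D K k s ^ n := by
  obtain ⟨n, rfl⟩ := Nat.exists_eq_succ_of_ne_zero hn
  rw [pow_succ, mul_assoc, x_mul_e]

theorem commute_X_X (k l : ℕ) : Commute (X D K k : D.KLR K ν) (X D K l) := by
  by_cases hk : k < height ν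
  · by_cases hl : l < height ν
    · refine eq_of_mul_e fun s => ?_
      have := rel_eq (Rel.x_comm (D := D) (K := K) ⟨k, hk⟩ ⟨l, hl⟩ s)
      rw [map_mul, map_mul, mk_fx, mk_fx] at this
      rw [mul_assoc, mul_assoc, X_mul_e hk, X_mul_e hl, X_mul_x hk, X_mul_x hl, this]
    · rw [X, X, dif_neg hl]
      exact Commute.zero_right _
  · rw [X, dif_neg hk]
    exact Commute.zero_left _

theorem commute_X_T (k l : ℕ) (h1 : l ≠ k) (h2 : l ≠ k + 1) :
    Commute (X D K l : D.KLR K ν) (T D K k) := by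
  by_cases hk : k < height ν - 1
  · by_cases hl : l < height ν
    · refine eq_of_mul_e fun s => ?_
      have := rel_eq (Rel.x_tau_far (D := D) (K := K) ⟨l, hl⟩ ⟨k, hk⟩ s
        (by simpa [lo] using h1) (by simpa [hi] using h2))
      rw [map_mul, map_mul, mk_fx, mk_fx, mk_ftau] at this
      rw [mul_assoc, mul_assoc, X_mul_e hl, T_mul_e hk, X_mul_tau hl, T_mul_x hk, this]
    · rw [X, dif_neg hl]
      exact Commute.zero_left _
  · rw [T, dif_neg hk]
    exact Commute.zero_right _

theorem commute_T_T (k l : ℕ) (h : k + 1 < l) : Commute (T D K k : D.KLR K ν) (T D K l) := by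
  by_cases hl : l < height ν - 1
  · have hk : k < height ν - 1 := by omega
    refine eq_of_mul_e fun s => ?_
    have := rel_eq (Rel.tau_far (D := D) (K := K) ⟨k, hk⟩ ⟨l, hl⟩ s h)
    rw [map_mul, map_mul, mk_ftau, mk_ftau, mk_ftau, mk_ftau] at this
    rw [mul_assoc, mul_assoc, T_mul_e hl, T_mul_e hk, T_mul_tau hk, T_mul_tau hl, this]
  · rw [T, T, dif_neg hl]
    exact Commute.zero_right _

theorem T_mul_T_mul_e {k l : ℕ} (hk : k < height ν - 1) (hl : l < height ν - 1) (s : WSeq ν) :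
    T D K k * T D K l * e D K s = tau D K ⟨k, hk⟩ (sw ⟨l, hl⟩ s) * tau D K ⟨l, hl⟩ s := by
  rw [mul_assoc, T_mul_e hl, T_mul_tau hk]

theorem T_mul_T_mul_T_mul_e {k l : ℕ} (hk : k < height ν - 1) (hl : l < height ν - 1)
    (s : WSeq ν) : T D K k * T D K l * T D K k * e D K s =
      tau D K ⟨k, hk⟩ (sw ⟨l, hl⟩ (sw ⟨k, hk⟩ s)) * tau D K ⟨l, hl⟩ (sw ⟨k, hk⟩ s) *
        tau D K ⟨k, hk⟩ s := by
  rw [mul_assoc, T_mul_e hk, mul_assoc, T_mul_tau hl, ← mul_assoc, T_mul_tau hk]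

section Local

variable {k : ℕ} (hk : k < height ν - 1) {s : WSeq ν}

theorem T_sq_of_eq (h : s.1 (lo ⟨k, hk⟩) = s.1 (hi ⟨k, hk⟩)) :
    T D K k * T D K k * e D K s = 0 := by
  have := rel_eq (Rel.tau_sq_eq (D := D) (K := K) _ s h)
  rw [map_mul, mk_ftau, mk_ftau, map_zero] at this
  rw [T_mul_T_mul_e hk hk, this]

theorem T_sq_of_dot_eq_zero (h : s.1 (lo ⟨k, hk⟩) ≠ s.1 (hi ⟨k, hk⟩))
    (h0 : D.dot (s.1 (lo ⟨k, hk⟩)) (s.1 (hi ⟨k, hk⟩)) = 0) :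
    T D K k * T D K k * e D K s = e D K s := by
  have := rel_eq (Rel.tau_sq_orth (D := D) (K := K) _ s h h0)
  rw [map_mul, mk_ftau, mk_ftau, mk_fe] at this
  rw [T_mul_T_mul_e hk hk, this]

theorem T_sq_of_ne (h : s.1 (lo ⟨k, hk⟩) ≠ s.1 (hi ⟨k, hk⟩))
    (h1 : D.negA (s.1 (lo ⟨k, hk⟩)) (s.1 (hi ⟨k, hk⟩)) ≠ 0)
    (h2 : D.negA (s.1 (hi ⟨k, hk⟩)) (s.1 (lo ⟨k, hk⟩)) ≠ 0) :
    T D K k * T D K k * e D K s =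
      X D K k ^ D.negA (s.1 (lo ⟨k, hk⟩)) (s.1 (hi ⟨k, hk⟩)) * e D K s +
      X D K (k + 1) ^ D.negA (s.1 (hi ⟨k, hk⟩)) (s.1 (lo ⟨k, hk⟩)) * e D K s := by
  have h0 : D.dot (s.1 (lo ⟨k, hk⟩)) (s.1 (hi ⟨k, hk⟩)) ≠ 0 := fun h' => by
    rcases mul_eq_zero.1 h' with h' | h'
    · exact (D.r_pos _).ne' h'
    · exact h1 (by simp [negA, h'])
  have := rel_eq (Rel.tau_sq (D := D) (K := K) _ s h h0)
  rw [map_mul, mk_ftau, mk_ftau, map_add, map_pow, map_pow, mk_fx, mk_fx] at this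
  rw [T_mul_T_mul_e hk hk, this, X_pow_mul_e (by omega), X_pow_mul_e (by omega),
    x_pow_mul_e s h1, x_pow_mul_e s h2]
  rfl

theorem T_mul_X_left (h : s.1 (lo ⟨k, hk⟩) = s.1 (hi ⟨k, hk⟩))
    (hr : D.IsReal (s.1 (lo ⟨k, hk⟩))) :
    T D K k * X D K k * e D K s = X D K (k + 1) * T D K k * e D K s + e D K s := by
  have := rel_eq (Rel.dot_real_right (D := D) (K := K) _ s h hr)
  rw [map_sub, map_mul, map_mul, mk_ftau, mk_fx, mk_fx, mk_fe, sub_eq_iff_eq_add] at this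
  rw [mul_assoc, X_mul_e (by omega), T_mul_x hk, mul_assoc, T_mul_e hk, X_mul_tau (by omega)]
  exact this.trans (add_comm _ _)

theorem T_mul_X_right (h : s.1 (lo ⟨k, hk⟩) = s.1 (hi ⟨k, hk⟩))
    (hr : D.IsReal (s.1 (lo ⟨k, hk⟩))) :
    T D K k * X D K (k + 1) * e D K s = X D K k * T D K k * e D K s - e D K s := by
  have := rel_eq (Rel.dot_real_left (D := D) (K := K) _ s h hr)
  rw [map_sub, map_mul, map_mul, mk_ftau, mk_fx, mk_fx, mk_fe, sub_eq_iff_eq_add] at this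
  rw [mul_assoc, X_mul_e (by omega), T_mul_x hk, mul_assoc, T_mul_e hk, X_mul_tau (by omega)]
  exact eq_sub_of_add_eq' this.symm

theorem T_braid (hk' : k + 1 < height ν - 1)
    (h : ¬(s.1 (lo ⟨k, hk⟩) = s.1 (hi ⟨k + 1, hk'⟩) ∧
      s.1 (lo ⟨k, hk⟩) ≠ s.1 (hi ⟨k, hk⟩))) :
    T D K k * T D K (k + 1) * T D K k * e D K s =
      T D K (k + 1) * T D K k * T D K (k + 1) * e D K s := by
  have := rel_eq (Rel.braid (D := D) (K := K) ⟨k, hk⟩ ⟨k + 1, hk'⟩ rfl s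
    fun h' => h ⟨h'.1, h'.2.2.1⟩)
  simp only [map_mul, mk_ftau] at this
  rw [T_mul_T_mul_T_mul_e hk hk', T_mul_T_mul_T_mul_e hk' hk, this]

theorem T_braid_real (hk' : k + 1 < height ν - 1) (hs : s.1 (lo ⟨k, hk⟩) = s.1 (hi ⟨k + 1, hk'⟩))
    (hr : D.IsReal (s.1 (lo ⟨k, hk⟩))) (hne : s.1 (lo ⟨k, hk⟩) ≠ s.1 (hi ⟨k, hk⟩))
    (h0 : D.dot (s.1 (lo ⟨k, hk⟩)) (s.1 (hi ⟨k, hk⟩)) ≠ 0) :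
    T D K (k + 1) * T D K k * T D K (k + 1) * e D K s =
      T D K k * T D K (k + 1) * T D K k * e D K s -
      ∑ c ∈ Finset.range (D.negA (s.1 (lo ⟨k, hk⟩)) (s.1 (hi ⟨k, hk⟩))), X D K k ^ c *
        X D K (k + 2) ^ (D.negA (s.1 (lo ⟨k, hk⟩)) (s.1 (hi ⟨k, hk⟩)) - 1 - c) * e D K s := by
  have := rel_eq (Rel.braid_real (D := D) (K := K) ⟨k, hk⟩ ⟨k + 1, hk'⟩ rfl s hs hr hne h0)
  simp only [map_sub, map_mul, map_sum, map_pow, mk_ftau, mk_fx, mk_fe] at this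
  rw [T_mul_T_mul_T_mul_e hk hk', T_mul_T_mul_T_mul_e hk' hk, eq_sub_iff_add_eq]
  refine Eq.trans ?_ (sub_eq_iff_eq_add'.1 this).symm
  refine congrArg₂ _ rfl (Finset.sum_congr rfl fun c _ => ?_)
  rw [mul_assoc, X_pow_mul_e (k := k + 2) (by omega), ← X_pow_mul_e (k := k + 2) (by omega),
    ← ((commute_e_X (k + 2) s).pow_right _).eq, ← mul_assoc, X_pow_mul_e (k := k) (by omega),
    mul_assoc, ((commute_e_X (k + 2) s).pow_right _).eq, X_pow_mul_e (k := k + 2) (by omega),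
    mul_assoc]
  rfl

end Local

end KLR
end BorcherdsCartanDatum

/-! ### The sequences i^a j i^{m-a} in R(mi + j) -/

namespace BorcherdsCartanDatum

variable {I : Type*} [Fintype I] [DecidableEq I] {D : BorcherdsCartanDatum I}

theorem height_serre (i j : I) (m : ℕ) :
    height (Pi.single i m + Pi.single j 1 : I → ℕ) = m + 1 := by
  simp [height, Finset.sum_add_distrib]

theorem serreSeq_hat_apply {i : I} (hi : D.IsReal i) (j : I) {a b m : ℕ} (h : a + b = m)
    (k : Fin (height (Pi.single i m + Pi.single j 1 : I → ℕ))) :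
    (D.serreSeq hi j a b m h).hat.1 k = if k.1 = a then j else i := by
  have hk := k.2.trans_eq (height_serre i j m)
  change ([(i, a), (j, 1), (i, b)].flatMap fun b => List.replicate b.2 b.1)[k.1]'_ = _
  simp only [List.flatMap_cons, List.flatMap_nil, List.append_nil, List.replicate_one,
    List.getElem_append, List.length_replicate, List.getElem_replicate, List.length_singleton,
    List.getElem_singleton]
  split_ifs <;> first | rfl | omega

/-- The sequence `i^a j i^{m-a}`, for `a ≤ m`. -/
noncomputable def serreWSeq {i : I} (hi : D.IsReal i) (j : I) (m a : ℕ) :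
    WSeq (Pi.single i m + Pi.single j 1 : I → ℕ) :=
  (D.serreSeq hi j (min a m) (m - min a m) m (by omega)).hat

theorem serreWSeq_apply {i : I} (hi : D.IsReal i) (j : I) {a m : ℕ} (h : a ≤ m)
    (k : Fin (height (Pi.single i m + Pi.single j 1 : I → ℕ))) :
    (serreWSeq hi j m a).1 k = if k.1 = a then j else i := by
  rw [serreWSeq, serreSeq_hat_apply, min_eq_left h]

theorem serreSeq_hat {i : I} (hi : D.IsReal i) (j : I) {a b m : ℕ} (h : a + b = m) :
    (D.serreSeq hi j a b m h).hat = serreWSeq hi j m a := by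
  apply Subtype.ext
  funext k
  rw [serreSeq_hat_apply, serreWSeq_apply hi j (by omega)]

section

open WSeq

variable {i j : I} (hi : D.IsReal i) {m a k : ℕ}

theorem sw_serreWSeq (ha : a ≤ m)
    (hk : k < height (Pi.single i m + Pi.single j 1 : I → ℕ) - 1) (h : k ≠ a) (h' : k + 1 ≠ a) :
    sw ⟨k, hk⟩ (serreWSeq hi j m a) = serreWSeq hi j m a := by
  apply sw_eq_self
  rw [serreWSeq_apply hi j ha, serreWSeq_apply hi j ha, if_neg (by simpa [lo] using h),
    if_neg (by simpa [WSeq.hi] using h')]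

theorem sw_serreWSeq_succ (ha : a < m)
    (hk : a < height (Pi.single i m + Pi.single j 1 : I → ℕ) - 1) :
    sw ⟨a, hk⟩ (serreWSeq hi j m (a + 1)) = serreWSeq hi j m a := by
  apply Subtype.ext
  funext t
  by_cases h1 : t = lo ⟨a, hk⟩
  · rw [h1, sw_lo, serreWSeq_apply hi j (by omega), serreWSeq_apply hi j (by omega)]
    simp [lo, WSeq.hi]
  · by_cases h2 : t = WSeq.hi ⟨a, hk⟩
    · rw [h2, sw_hi, serreWSeq_apply hi j (by omega), serreWSeq_apply hi j (by omega)]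
      simp [lo, WSeq.hi]
    · rw [sw_of_ne _ _ _ h1 h2, serreWSeq_apply hi j (by omega), serreWSeq_apply hi j (by omega)]
      rw [Fin.ext_iff] at h1 h2
      simp only [lo, WSeq.hi] at h1 h2
      rw [if_neg h1, if_neg h2]

theorem sw_serreWSeq_self (ha : a < m)
    (hk : a < height (Pi.single i m + Pi.single j 1 : I → ℕ) - 1) :
    sw ⟨a, hk⟩ (serreWSeq hi j m a) = serreWSeq hi j m (a + 1) := by
  rw [← sw_serreWSeq_succ hi ha hk, sw_sw]

end

namespace KLR

open WSeq

variable (K : Type*) [Field K] {i j : I} {m : ℕ}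

set_option maxHeartbeats 1000000 in
-- Each local relation is read off from the colours at the positions involved. Because m - 1 =
-- -a_{ij}, this number is both the exponent in τ² and the number of terms in the braid error; the
-- other exponent, -a_{ji}, never affects the result.
theorem serreRelations (hi : D.IsReal i) (hij : i ≠ j) (hm : (m : ℤ) = 1 - D.A i j) :
    NilHecke.SerreRelations (T D K (ν := Pi.single i m + Pi.single j 1)) (X D K)
      (fun a => e D K (serreWSeq hi j m a)) m (D.negA j i) := by
  have hht := height_serre i j m
  have hoff := D.off_diag i j hij
  have hn : D.negA i j = m - 1 := by simp only [negA]; omega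
  have hd : 1 < m → D.dot i j ≠ 0 := fun h =>
    mul_ne_zero (D.r_pos i).ne' (by omega)
  have hd' : D.dot j i = D.dot i j := (D.symm i j).symm
  -- By symmetrizability a_{ij} and a_{ji} vanish together, so both exponents in τ² are nonzero once
  -- m > 1.
  have hn' : 1 < m → D.negA j i ≠ 0 := fun h => by
    have h1 : D.A j i ≠ 0 := fun h' => hd h (by rw [← hd', dot, h', mul_zero])
    have h2 := D.off_diag j i hij.symm
    simp only [negA]; omega
  have hlt : ∀ k, k < m → k < height (Pi.single i m + Pi.single j 1 : I → ℕ) - 1 := by omega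
  have hlo : ∀ a k, (hk : k < height (Pi.single i m + Pi.single j 1 : I → ℕ) - 1) → a ≤ m →
      (serreWSeq hi j m a).1 (lo ⟨k, hk⟩) = if k = a then j else i :=
    fun a k hk ha => serreWSeq_apply hi j ha _
  have hhi : ∀ a k, (hk : k < height (Pi.single i m + Pi.single j 1 : I → ℕ) - 1) → a ≤ m →
      (serreWSeq hi j m a).1 (WSeq.hi ⟨k, hk⟩) = if k + 1 = a then j else i :=
    fun a k hk ha => serreWSeq_apply hi j ha _
  have hii : ∀ a k, k + 1 < a ∧ a ≤ m ∨ a < k ∧ k < m →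
      (hk : k < height (Pi.single i m + Pi.single j 1 : I → ℕ) - 1) →
      (serreWSeq hi j m a).1 (lo ⟨k, hk⟩) = i ∧ (serreWSeq hi j m a).1 (WSeq.hi ⟨k, hk⟩) = i :=
    fun a k h hk => by
      rw [hlo a k hk (by omega), hhi a k hk (by omega), if_neg (by omega), if_neg (by omega)]
      exact ⟨rfl, rfl⟩
  refine
    { e_e := fun a _ => e_mul_self _
      e_x := fun a k => commute_e_X k _
      e_t := fun a k h => ?_
      e_t_self := fun a ha => ?_
      e_succ_t := fun a ha => ?_
      x_x := commute_X_X
      x_t := commute_X_T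
      t_t := commute_T_T
      sq := fun a k h => ?_
      dot_left := fun a k h => ?_
      dot_right := fun a k h => ?_
      braid := fun a k ha hk h => ?_
      braid_mid := fun a ha => ?_
      sq_first := fun h => ?_
      sq_last := fun h => ?_
      sq_first_one := fun h => ?_
      sq_last_one := fun h => ?_ }
  · have := e_mul_T (D := D) (K := K) (hlt k (by omega)) (serreWSeq hi j m a)
    rwa [sw_serreWSeq hi (by omega) _ (by omega) (by omega)] at this
  · have := e_mul_T (D := D) (K := K) (hlt a ha) (serreWSeq hi j m (a + 1))
    rwa [sw_serreWSeq_succ hi ha] at this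
  · have := e_mul_T (D := D) (K := K) (hlt a ha) (serreWSeq hi j m a)
    rwa [sw_serreWSeq_self hi ha] at this
  · obtain ⟨h1, h2⟩ := hii a k h (hlt k (by omega))
    exact T_sq_of_eq (hlt k (by omega)) (h1.trans h2.symm)
  · obtain ⟨h1, h2⟩ := hii a k h (hlt k (by omega))
    exact T_mul_X_left (hlt k (by omega)) (h1.trans h2.symm) (by rwa [h1])
  · obtain ⟨h1, h2⟩ := hii a k h (hlt k (by omega))
    exact T_mul_X_right (hlt k (by omega)) (h1.trans h2.symm) (by rwa [h1])
  · refine T_braid (hlt k (by omega)) (hlt (k + 1) (by omega)) ?_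
    rw [hlo a k _ ha, hhi a k _ ha, hhi a (k + 1) _ ha, if_neg h.symm]
    split_ifs <;> first | omega | simp
  · have h1 := hlo (a + 1) a (hlt a (by omega)) (by omega)
    have h2 := hhi (a + 1) a (hlt a (by omega)) (by omega)
    have h3 := hhi (a + 1) (a + 1) (hlt (a + 1) (by omega)) (by omega)
    rw [if_neg (by omega)] at h1 h3
    rw [if_pos rfl] at h2
    have := T_braid_real (D := D) (K := K) (hlt a (by omega)) (hlt (a + 1) (by omega))
      (h1.trans h3.symm) (by rwa [h1]) (by rwa [h1, h2]) (by rw [h1, h2]; exact hd (by omega))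
    simpa only [h1, h2, hn, Nat.sub_sub] using this
  · have h1 := hlo 0 0 (hlt 0 (by omega)) (by omega)
    have h2 := hhi 0 0 (hlt 0 (by omega)) (by omega)
    rw [if_pos rfl] at h1
    rw [if_neg (by omega)] at h2
    have := T_sq_of_ne (D := D) (K := K) (hlt 0 (by omega)) (by rw [h1, h2]; exact hij.symm)
      (by rw [h1, h2]; exact hn' h) (by rw [h1, h2]; omega)
    simpa only [h1, h2, hn] using this
  · have h1 := hlo m (m - 1) (hlt (m - 1) (by omega)) (by omega)
    have h2 := hhi m (m - 1) (hlt (m - 1) (by omega)) (by omega)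
    rw [if_pos (by omega)] at h2
    rw [if_neg (by omega)] at h1
    have := T_sq_of_ne (D := D) (K := K) (hlt (m - 1) (by omega)) (by rw [h1, h2]; exact hij)
      (by rw [h1, h2]; omega) (by rw [h1, h2]; exact hn' h)
    simpa only [h1, h2, hn, Nat.sub_add_cancel h.le] using this
  · have h1 := hlo 0 0 (hlt 0 (by omega)) (by omega)
    have h2 := hhi 0 0 (hlt 0 (by omega)) (by omega)
    rw [if_pos rfl] at h1
    rw [if_neg (by omega)] at h2
    refine T_sq_of_dot_eq_zero (hlt 0 (by omega)) (by rw [h1, h2]; exact hij.symm) ?_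
    rw [h1, h2, hd', dot, show D.A i j = 0 by omega, mul_zero]
  · have h1 := hlo 1 0 (hlt 0 (by omega)) (by omega)
    have h2 := hhi 1 0 (hlt 0 (by omega)) (by omega)
    rw [if_neg (by omega)] at h1
    rw [if_pos (by omega)] at h2
    refine T_sq_of_dot_eq_zero (hlt 0 (by omega)) (by rw [h1, h2]; exact hij) ?_
    rw [h1, h2, dot, show D.A i j = 0 by omega, mul_zero]

/-! ### The flip ψ and the images of the divided-power idempotents -/

variable {K} {ν : I → ℕ}

theorem psi_mul (y z : D.KLR K ν) : psi D K (y * z) = psi D K z * psi D K y := by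
  simp [psi]

theorem psi_one : psi D K (1 : D.KLR K ν) = 1 := by
  simp [psi]

theorem psi_sum {ι : Type*} (s : Finset ι) (f : ι → D.KLR K ν) :
    psi D K (∑ c ∈ s, f c) = ∑ c ∈ s, psi D K (f c) := by
  simp [psi]

theorem psi_zero : psi D K (0 : D.KLR K ν) = 0 := by
  simp [psi]

theorem psi_gen (g : Gen ν) : psi D K (gen D K g) = gen D K (flipGen g) := by
  simp [psi, psiHom, gen, flipFree]

theorem psi_e (s : WSeq ν) : psi D K (e D K s) = e D K s := psi_gen _

theorem psi_X (k : ℕ) : psi D K (X D K k : D.KLR K ν) = X D K k := by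
  unfold X
  split_ifs
  · rw [psi_sum]
    exact Finset.sum_congr rfl fun s _ => psi_gen _
  · exact psi_zero

/-- The flip permutes the summands of `T D K k` through the involution s_k on sequences. -/
theorem psi_T (k : ℕ) : psi D K (T D K k : D.KLR K ν) = T D K k := by
  unfold T
  split_ifs with h
  · rw [psi_sum]
    exact Fintype.sum_bijective (sw ⟨k, h⟩)
      (Function.Involutive.bijective fun s => sw_sw _ s) _ _ fun s => psi_gen _
  · exact psi_zero

theorem psi_pow (z : D.KLR K ν) (n : ℕ) : psi D K (z ^ n) = psi D K z ^ n := by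
  simp [psi]

theorem prod_eq_desc (p n : ℕ) : ((List.range n).reverse.map fun t => T D K (p + t)).prod =
    NilHecke.desc (T D K (ν := ν)) p n := by
  induction n with
  | zero => rfl
  | succ n ih => simp [List.range_succ, NilHecke.desc, ← ih]

theorem longest_eq (p n : ℕ) : longest D K p n = NilHecke.long (T D K (ν := ν)) p n := by
  induction n with
  | zero => rfl
  | succ n ih => rw [longest, ih, prod_eq_desc, NilHecke.long]

theorem prod_eq_stair (p n : ℕ) : ((List.range n).map fun t => X D K (p + t) ^ (n - 1 - t)).prod =
    NilHecke.stair (X D K (ν := ν)) p n := by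
  induction n generalizing p with
  | zero => rfl
  | succ n ih =>
    rw [List.range_succ_eq_map, List.map_cons, List.prod_cons, NilHecke.stair, ← ih, List.map_map]
    refine congrArg₂ _ (by simp) (congrArg List.prod (List.map_congr_left fun t _ => ?_))
    simp only [Function.comp]
    congr 1
    · congr 1; omega
    · omega

theorem psi_desc (p n : ℕ) : psi D K (NilHecke.desc (T D K (ν := ν)) p n) =
    NilHecke.asc (T D K) p n := by
  induction n with
  | zero => exact psi_one
  | succ n ih => rw [NilHecke.desc, psi_mul, ih, psi_T, NilHecke.asc]

/-- Reversal turns the word into the other recursive form of the half twist, given by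
`long_succ_eq_asc_mul`. -/
theorem psi_long (p n : ℕ) : psi D K (NilHecke.long (T D K (ν := ν)) p n) =
    NilHecke.long (T D K) p n := by
  induction n with
  | zero => exact psi_one
  | succ n ih =>
    rw [show NilHecke.long (T D K (ν := ν)) p (n + 1) = NilHecke.long (T D K) p n *
      NilHecke.desc (T D K) p n from rfl, psi_mul, psi_desc, ih,
      ← NilHecke.long_succ_eq_asc_mul fun k l _ h _ => commute_T_T k l h]
    rfl

theorem psi_stair (p n : ℕ) : psi D K (NilHecke.stair (X D K (ν := ν)) p n) =
    NilHecke.stair (X D K) p n := by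
  induction n generalizing p with
  | zero => exact psi_one
  | succ n ih =>
    rw [NilHecke.stair, psi_mul, ih, psi_pow, psi_X]
    exact (NilHecke.commute_stair fun k _ _ => (commute_X_X p k).pow_left n).eq.symm

theorem psi_nilIdem (p n : ℕ) : psi D K (nilIdem D K p n : D.KLR K ν) =
    NilHecke.long (T D K) p n * NilHecke.stair (X D K) p n := by
  rw [nilIdem, psi_mul, prod_eq_stair, longest_eq, psi_long, psi_stair]

theorem nilIdem_one (p : ℕ) : (nilIdem D K p 1 : D.KLR K ν) = 1 := by
  simp [nilIdem, longest]

/-- Since ψ reverses products, the half twist comes before the staircase in each block and the right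
block comes before the left one; the two blocks commute. The block of the single letter `j`
contributes 1. -/
theorem psi_idem_serreSeq (hi : D.IsReal i) (hij : i ≠ j) (hm : (m : ℤ) = 1 - D.A i j)
    {a b : ℕ} (h : a + b = m) :
    psi D K ((D.serreSeq hi j a b m h).idem K) =
      NilHecke.blocks (T D K) (X D K) a b * e D K (serreWSeq hi j m a) := by
  have S := serreRelations K hi hij hm
  have c : Commute (NilHecke.long (T D K) 0 a * NilHecke.stair (X D K) 0 a :
      D.KLR K (Pi.single i m + Pi.single j 1))
      (NilHecke.long (T D K) (a + 1) b * NilHecke.stair (X D K) (a + 1) b) :=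
    ((S.long_commute_long (by omega)).mul_right
      (S.stair_commute_long (by omega)).symm).mul_left
      ((S.stair_commute_long (by omega)).mul_right (S.stair_commute_stair _ _ _ _))
  rw [DSeq.idem, psi_mul, psi_e, serreSeq_hat]
  simp only [serreSeq, blockIdem, nilIdem_one, one_mul, mul_one, psi_mul, psi_nilIdem, zero_add]
  rw [← c.eq]
  rfl

end KLR
end BorcherdsCartanDatum

/-! ### The matrix of the Serre relation and its square -/

namespace NilHecke

variable {R : Type*} [Ring R] (T X E : ℕ → R) (m : ℕ)

/-- The map which moves a strand of colour `i` through the strand of colour `j`, from the right to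
the left. -/
def up (a : ℕ) : R := desc T a (m - a) * (blocks T X (a + 1) (m - (a + 1)) * E (a + 1))

/-- The map which moves a strand of colour `i` through the strand of colour `j`, from the left to
the right. -/
def down (a : ℕ) : R := asc T 0 (a + 1) * (blocks T X a (m - a) * E a)

/-- The matrix of the categorified Serre relation. -/
def serreMatrix (a b : ℕ) : R :=
  (if a + 1 = b then (-1) ^ a * up T X E m a else 0) + if b + 1 = a then down T X E m b else 0

namespace SerreRelations

variable {T X E : ℕ → R} {m q : ℕ} {a : ℕ}

theorem e_mul_up (S : SerreRelations T X E m q)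
    (h : a < m) : E a * up T X E m a = up T X E m a := by
  obtain ⟨b, rfl⟩ : ∃ b, m = a + (b + 1) := ⟨m - a - 1, by omega⟩
  have he := S.e_e (a + 1) (by omega)
  rw [up, show a + (b + 1) - a = b + 1 by omega, show a + (b + 1) - (a + 1) = b by omega,
    desc_succ', mul_assoc]
  exact S.e_mul_desc (by omega) (S.e_mul_t_self (by omega) (S.e_mul_blocks (by omega) he))

theorem e_mul_down (S : SerreRelations T X E m q)
    (h : a < m) : E (a + 1) * down T X E m a = down T X E m a := by
  have he := S.e_e a (by omega)
  rw [down, asc, mul_assoc, zero_add]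
  exact S.e_mul_asc (by omega) (S.e_mul_succ_t (by omega) (S.e_mul_blocks (by omega) he))

/-- Together with `blocks_mul_down`, this allows the idempotent in the middle of a product of two
such maps to be dropped. -/
theorem blocks_mul_up (S : SerreRelations T X E m q) (h : a < m) :
    blocks T X a (m - a) * up T X E m a = up T X E m a := by
  obtain ⟨b, rfl⟩ : ∃ b, m = a + (b + 1) := ⟨m - a - 1, by omega⟩
  have he := S.e_e (a + 1) (by omega)
  rw [up, show a + (b + 1) - a = b + 1 by omega, show a + (b + 1) - (a + 1) = b by omega]
  exact S.blocks_mul_desc rfl he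

theorem blocks_mul_down (S : SerreRelations T X E m q) (h : a < m) :
    blocks T X (a + 1) (m - (a + 1)) * down T X E m a = down T X E m a := by
  obtain ⟨b, rfl⟩ : ∃ b, m = a + (b + 1) := ⟨m - a - 1, by omega⟩
  have he := S.e_e a (by omega)
  rw [down, show a + (b + 1) - a = b + 1 by omega, show a + (b + 1) - (a + 1) = b by omega]
  exact S.blocks_mul_asc rfl he

theorem up_mul_up (S : SerreRelations T X E m q)
    (h : a + 1 < m) : up T X E m a * up T X E m (a + 1) = 0 := by
  obtain ⟨b, rfl⟩ : ∃ b, m = a + (b + 2) := ⟨m - a - 2, by omega⟩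
  rw [up, mul_assoc, mul_assoc, S.e_mul_up h, S.blocks_mul_up h, up,
    show a + (b + 2) - a = b + 2 by omega, show a + (b + 2) - (a + 1) = b + 1 by omega,
    show a + (b + 2) - (a + 1 + 1) = b by omega]
  exact S.desc_mul_desc rfl (S.e_e _ (by omega))

theorem down_mul_down (S : SerreRelations T X E m q)
    (h : a + 1 < m) : down T X E m (a + 1) * down T X E m a = 0 := by
  obtain ⟨b, rfl⟩ : ∃ b, m = a + (b + 2) := ⟨m - a - 2, by omega⟩
  have h' : a < a + (b + 2) := by omega
  rw [down, mul_assoc, mul_assoc, S.e_mul_down h', S.blocks_mul_down h', down,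
    show a + (b + 2) - a = b + 2 by omega]
  exact S.asc_mul_asc rfl (S.e_e _ (by omega))

theorem up_mul_down (S : SerreRelations T X E m q) (h : a < m) : up T X E m a * down T X E m a =
    desc T a (m - a) * (asc T 0 (a + 1) * (blocks T X a (m - a) * E a)) := by
  rw [up, mul_assoc, mul_assoc, S.e_mul_down h, S.blocks_mul_down h, down]

theorem down_mul_up (S : SerreRelations T X E m q) (h : a < m) : down T X E m a * up T X E m a =
    asc T 0 (a + 1) * (desc T a (m - a) * (blocks T X (a + 1) (m - (a + 1)) * E (a + 1))) := by
  rw [down, mul_assoc, mul_assoc, S.e_mul_up h, S.blocks_mul_up h, up]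

theorem up_mul_down_zero (S : SerreRelations T X E m q) (hm : 0 < m) :
    up T X E m 0 * down T X E m 0 = blocks T X 0 m * E 0 := by
  rw [S.up_mul_down hm, Nat.sub_zero, zero_add]
  have he := S.e_e 0 (by omega)
  exact S.desc_asc_first hm (S.e_mul_blocks (zero_add m) he)
    fun k hk => S.t_mul_blocks (zero_add m) he (by omega)

theorem down_mul_up_last (S : SerreRelations T X E m q) (h : a + 1 = m) :
    down T X E m a * up T X E m a = -((-1) ^ m * (blocks T X m 0 * E m)) := by
  subst h
  rw [S.down_mul_up (by omega)]
  have he := S.e_e (a + 1) (by omega)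
  have := S.asc_desc_last (by omega) (S.e_mul_blocks (b := 0) rfl he)
    fun k hk => S.t_mul_blocks (b := 0) rfl he (by omega)
  rw [Nat.add_sub_cancel] at this
  rw [Nat.add_sub_cancel_left, Nat.sub_self]
  exact this

theorem up_mul_down_sub (S : SerreRelations T X E m q) (h : a + 1 < m) :
    up T X E m (a + 1) * down T X E m (a + 1) - down T X E m a * up T X E m a =
      (-1) ^ (a + 1) * (blocks T X (a + 1) (m - (a + 1)) * E (a + 1)) := by
  obtain ⟨b, rfl⟩ : ∃ b, m = a + 1 + (b + 1) := ⟨m - a - 2, by omega⟩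
  have he := S.e_e (a + 1) (by omega)
  rw [S.up_mul_down h, S.down_mul_up (by omega), show a + 1 + (b + 1) - (a + 1) = b + 1 by omega,
    show a + 1 + (b + 1) - a = b + 2 by omega]
  exact S.desc_asc_sub_asc_desc rfl (S.e_mul_blocks rfl he)
    fun k hk => S.t_mul_blocks rfl he (by omega)

/-- Off the diagonal only products of two `up` or of two `down` can occur, and these vanish. On the
diagonal the sign in the matrix turns the sum into (-1)^a times the difference U_a D_a - D_{a-1}
U_{a-1}, which equals (-1)^a ε_a; the signs cancel. -/
theorem serreMatrix_sq (S : SerreRelations T X E m q)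
    {c : ℕ} (hm : 0 < m) (ha : a ≤ m) (hc : c ≤ m) :
    ∑ b ∈ Finset.range (m + 1), serreMatrix T X E m a b * serreMatrix T X E m b c =
      if a = c then blocks T X a (m - a) * E a else 0 := by
  have h1 : ∀ b, b ∈ Finset.range (m + 1) ↔ b ≤ m := fun b => by rw [Finset.mem_range]; omega
  -- Row `a` is supported in the columns a + 1 and a - 1. The guards discard the neighbours outside
  -- 0, …, m and make the truncated subtraction harmless.
  have h2 : ∑ b ∈ Finset.range (m + 1), serreMatrix T X E m a b * serreMatrix T X E m b c =
      (if a < m then (-1) ^ a * up T X E m a * serreMatrix T X E m (a + 1) c else 0) +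
      if 0 < a then down T X E m (a - 1) * serreMatrix T X E m (a - 1) c else 0 := by
    conv_lhs => enter [2, b]; rw [serreMatrix, add_mul, ite_mul, ite_mul, zero_mul]
    rw [Finset.sum_add_distrib, Finset.sum_ite_eq]
    congr 1
    · simp only [h1, Nat.succ_le_iff]
    · rcases a with _ | a
      · simp
      · simp only [add_left_inj, Finset.sum_ite_eq', h1, Nat.add_sub_cancel, Nat.succ_pos]
        simp [show a ≤ m by omega]
  rw [h2]
  have hsq : ((-1 : R) ^ a) * (-1) ^ a = 1 := by rw [← pow_add, ← two_mul, pow_mul]; simp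
  have h3 : (if a < m then (-1) ^ a * up T X E m a * serreMatrix T X E m (a + 1) c else 0) =
      if a = c then (if a < m then (-1) ^ a * (up T X E m a * down T X E m a) else 0) else 0 := by
    by_cases ham : a < m
    · rw [if_pos ham, if_pos ham, serreMatrix]
      by_cases hca : a = c
      · subst hca
        rw [if_pos rfl, if_pos rfl, if_neg (by omega), zero_add, mul_assoc]
      · rw [if_neg hca, if_neg (show ¬(c + 1 = a + 1) by omega), add_zero]
        split_ifs with hc2
        · rw [mul_assoc, (((Commute.neg_one_left _).pow_left (a + 1)).symm).left_comm,
            S.up_mul_up (by omega), mul_zero, mul_zero]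
        · rw [mul_zero]
    · simp [ham]
  have h4 : (if 0 < a then down T X E m (a - 1) * serreMatrix T X E m (a - 1) c else 0) =
      if a = c then (if 0 < a then
        -((-1) ^ a * (down T X E m (a - 1) * up T X E m (a - 1))) else 0) else 0 := by
    rcases a with _ | a
    · simp
    · rw [if_pos (Nat.succ_pos a), if_pos (Nat.succ_pos a), serreMatrix, Nat.add_sub_cancel]
      by_cases hca : a + 1 = c
      · subst hca
        rw [if_pos rfl, if_pos rfl, if_neg (by omega), add_zero,
          (((Commute.neg_one_left _).pow_left a).symm).left_comm, pow_succ]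
        simp
      · rw [if_neg hca, if_neg hca, zero_add]
        split_ifs with hc2
        · subst hc2
          exact S.down_mul_down (by omega)
        · rw [mul_zero]
  rw [h3, h4]
  -- On the diagonal the live cases are 0 < a < m, then a = 0, then a = m.
  split_ifs with hac h5 h6 h6
  · obtain ⟨a, rfl⟩ : ∃ b, a = b + 1 := ⟨a - 1, by omega⟩
    rw [Nat.add_sub_cancel, ← sub_eq_add_neg, ← mul_sub, S.up_mul_down_sub h5, ← mul_assoc, hsq,
      one_mul]
  · obtain rfl : a = 0 := by omega
    rw [S.up_mul_down_zero hm, pow_zero, one_mul, add_zero, Nat.sub_zero]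
  · obtain rfl : a = m := by omega
    rw [S.down_mul_up_last (by omega), mul_neg, neg_neg, ← mul_assoc, hsq, one_mul, zero_add,
      Nat.sub_self]
  · omega
  · exact add_zero 0

end SerreRelations

theorem serreMatrix_eq_zero {a b : ℕ} (h : a % 2 = b % 2) : serreMatrix T X E m a b = 0 := by
  rw [serreMatrix, if_neg (by omega), if_neg (by omega), add_zero]

end NilHecke

/-! ### Graded isomorphisms given by right multiplication -/

namespace BorcherdsCartanDatum

variable {I : Type*} [Fintype I] [DecidableEq I] {D : BorcherdsCartanDatum I}
  {K : Type*} [Field K] {ν : I → ℕ}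

namespace KLR

theorem mul_mem_grading {c d : ℤ} {y z : D.KLR K ν} (hy : y ∈ grading D K c)
    (hz : z ∈ grading D K d) : y * z ∈ grading D K (c + d) := by
  have h : grading D K c * grading D K d ≤ (grading D K (c + d) : Submodule K (D.KLR K ν)) := by
    rw [grading, grading, Submodule.span_mul_span]
    refine Submodule.span_mono ?_
    rintro _ ⟨_, ⟨v, hv, rfl⟩, _, ⟨w, hw, rfl⟩, rfl⟩
    exact ⟨v ++ w, by simp [hv, hw], by simp⟩
  exact h (Submodule.mul_mem_mul hy hz)

theorem gen_mem_grading (g : Gen ν) : gen D K g ∈ grading D K (D.genDeg g) :=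
  Submodule.subset_span ⟨[g], by simp, by simp⟩

end KLR

open KLR

theorem DSeq.mem_PGrading {s : D.DSeq ν} {d : ℤ} {z : s.P K} :
    z ∈ s.PGrading K d ↔ (z : D.KLR K ν) ∈ grading D K (d + s.shift) := by
  rw [DSeq.PGrading, sub_neg_eq_add]
  rfl

/-- The generator of the ideal is an idempotent, so right multiplication by it is the identity of
the ideal. -/
theorem DSeq.mul_psi_of_mem {s : D.DSeq ν}
    (hs : psi D K (s.idem K) * psi D K (s.idem K) = psi D K (s.idem K)) {z : D.KLR K ν}
    (hz : z ∈ s.P K) : z * psi D K (s.idem K) = z := by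
  obtain ⟨r, rfl⟩ := Submodule.mem_span_singleton.1 hz
  rw [smul_eq_mul, mul_assoc, hs]

/-- Right multiplication by an element of a left ideal. -/
def rightMul {R : Type*} [Ring R] (P Q : Submodule R R) (u : Q) : P →ₗ[R] Q :=
  ((LinearMap.toSpanSingleton R R (u : R)).domRestrict P).codRestrict Q
    fun z => Q.smul_mem (z : R) u.2

theorem coe_rightMul {R : Type*} [Ring R] {P Q : Submodule R R} (u : Q) (z : P) :
    (rightMul P Q u z : R) = z * u := rfl

/-- Projective modules which are related by mutually inverse elements are isomorphic. -/
theorem gradedIso_of_mul_eq {s t : D.DSeq ν} {u v : D.KLR K ν} (hu : u ∈ t.P K) (hv : v ∈ s.P K)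
    (hud : u ∈ grading D K (t.shift - s.shift)) (hvd : v ∈ grading D K (s.shift - t.shift))
    (huv : u * v = psi D K (s.idem K)) (hvu : v * u = psi D K (t.idem K))
    (hs : psi D K (s.idem K) * psi D K (s.idem K) = psi D K (s.idem K))
    (ht : psi D K (t.idem K) * psi D K (t.idem K) = psi D K (t.idem K)) :
    GradedIso (D.KLR K ν) (s.PGrading K) (t.PGrading K) := by
  have h1 : ∀ z, rightMul (t.P K) (s.P K) ⟨v, hv⟩ (rightMul (s.P K) (t.P K) ⟨u, hu⟩ z) = z :=
    fun z => Subtype.ext (by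
      rw [coe_rightMul, coe_rightMul, mul_assoc, huv, DSeq.mul_psi_of_mem hs z.2])
  have h2 : ∀ z, rightMul (s.P K) (t.P K) ⟨u, hu⟩ (rightMul (t.P K) (s.P K) ⟨v, hv⟩ z) = z :=
    fun z => Subtype.ext (by
      rw [coe_rightMul, coe_rightMul, mul_assoc, hvu, DSeq.mul_psi_of_mem ht z.2])
  refine ⟨LinearEquiv.ofLinearMap (rightMul _ _ ⟨u, hu⟩) (rightMul _ _ ⟨v, hv⟩)
    (LinearMap.ext h2) (LinearMap.ext h1), fun d z => ?_⟩
  rw [DSeq.mem_PGrading, DSeq.mem_PGrading]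
  constructor
  · intro h
    have := mul_mem_grading h hud
    rwa [show d + s.shift + (t.shift - s.shift) = d + t.shift by ring] at this
  · intro h
    have := mul_mem_grading h hvd
    rw [show d + t.shift + (s.shift - t.shift) = d + s.shift by ring] at this
    rwa [show (z : D.KLR K ν) = _ from congrArg Subtype.val (h1 z).symm]

theorem mem_directSumGrading {ι : Type*} {s : ι → D.DSeq ν} {d : ℤ} {z : ⨁ c, (s c).P K} :
    z ∈ directSumGrading K (fun c => (s c).PGrading K) d ↔
      ∀ c, (z c : D.KLR K ν) ∈ grading D K (d + (s c).shift) := by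
  simp only [directSumGrading, Submodule.mem_iInf, Submodule.mem_comap]
  exact forall_congr' fun c => DSeq.mem_PGrading

section Matrix

variable {ι κ : Type*} [Fintype ι] [Fintype κ]

/-- Right multiplication by a matrix. -/
noncomputable def matrixMul {R : Type*} [Ring R] (P : ι → Submodule R R) (Q : κ → Submodule R R)
    (α : ∀ (_ : ι) (d : κ), Q d) : (⨁ c, P c) →ₗ[R] ⨁ d, Q d :=
  (DirectSum.linearEquivFunOnFintype R κ fun d => Q d).symm.toLinearMap ∘ₗ
    LinearMap.pi (fun d => ∑ c, rightMul (P c) (Q d) (α c d) ∘ₗ DirectSum.component R ι _ c)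

theorem coe_matrixMul_apply {R : Type*} [Ring R] {P : ι → Submodule R R}
    {Q : κ → Submodule R R} (α : ∀ (_ : ι) (d : κ), Q d) (z : ⨁ c, P c) (d : κ) :
    (matrixMul P Q α z d : R) = ∑ c, (z c : R) * α c d := by
  have h : matrixMul P Q α z d = ∑ c, rightMul (P c) (Q d) (α c d) (z c) := by
    change (DirectSum.linearEquivFunOnFintype R κ fun d => Q d) (matrixMul P Q α z) d = _
    rw [matrixMul, LinearMap.comp_apply, LinearEquiv.coe_coe, LinearEquiv.apply_symm_apply]
    simp only [LinearMap.pi_apply, LinearMap.sum_apply]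
    rfl
  rw [h, AddSubmonoidClass.coe_finsetSum]
  rfl

/-- Elements of the direct sum are row vectors multiplied on the right, so the composite is given by
the product αβ in this order. -/
theorem matrixMul_matrixMul [DecidableEq ι] {R : Type*} [Ring R] {P : ι → Submodule R R}
    {Q : κ → Submodule R R} {α : ∀ (_ : ι) (d : κ), Q d} {β : ∀ (_ : κ) (c : ι), P c} {e : ι → R}
    (h : ∀ c c', ∑ d, (α c d : R) * β d c' = if c = c' then e c else 0)
    (he : ∀ c, ∀ z ∈ P c, z * e c = z) (z : ⨁ c, P c) :
    matrixMul Q P β (matrixMul P Q α z) = z := by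
  refine DFinsupp.ext fun c' => Subtype.ext ?_
  change (matrixMul Q P β (matrixMul P Q α z) c' : R) = (z c' : R)
  simp only [coe_matrixMul_apply, Finset.sum_mul, mul_assoc]
  rw [Finset.sum_comm]
  simp only [← Finset.mul_sum, h, mul_ite, mul_zero]
  rw [Finset.sum_ite_eq', if_pos (Finset.mem_univ _), he c' _ (z c').2]

theorem matrixMul_mem_directSumGrading {s : ι → D.DSeq ν} {t : κ → D.DSeq ν}
    {α : ∀ (_ : ι) (d : κ), (t d).P K}
    (hα : ∀ c d, (α c d : D.KLR K ν) ∈ grading D K ((t d).shift - (s c).shift)) {d : ℤ}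
    {z : ⨁ c, (s c).P K} (hz : z ∈ directSumGrading K (fun c => (s c).PGrading K) d) :
    matrixMul (fun c => (s c).P K) (fun d => (t d).P K) α z ∈
      directSumGrading K (fun c => (t c).PGrading K) d := by
  rw [mem_directSumGrading] at hz ⊢
  intro b
  rw [coe_matrixMul_apply]
  refine Submodule.sum_mem _ fun c _ => ?_
  have := mul_mem_grading (hz c) (hα c b)
  rwa [show d + (s c).shift + ((t b).shift - (s c).shift) = d + (t b).shift by ring] at this

theorem gradedIso_of_matrix [DecidableEq ι] [DecidableEq κ] {s : ι → D.DSeq ν}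
    {t : κ → D.DSeq ν} {α : ι → κ → D.KLR K ν}
    {β : κ → ι → D.KLR K ν} (hα : ∀ c d, α c d ∈ (t d).P K) (hβ : ∀ d c, β d c ∈ (s c).P K)
    (hαd : ∀ c d, α c d ∈ grading D K ((t d).shift - (s c).shift))
    (hβd : ∀ d c, β d c ∈ grading D K ((s c).shift - (t d).shift))
    (hαβ : ∀ c c', ∑ d, α c d * β d c' = if c = c' then psi D K ((s c).idem K) else 0)
    (hβα : ∀ d d', ∑ c, β d c * α c d' = if d = d' then psi D K ((t d).idem K) else 0)
    (hs : ∀ c, psi D K ((s c).idem K) * psi D K ((s c).idem K) = psi D K ((s c).idem K))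
    (ht : ∀ c, psi D K ((t c).idem K) * psi D K ((t c).idem K) = psi D K ((t c).idem K)) :
    GradedIso (D.KLR K ν) (directSumGrading K fun c => (s c).PGrading K)
      (directSumGrading K fun d => (t d).PGrading K) := by
  have h1 := matrixMul_matrixMul (P := fun c => (s c).P K) (Q := fun d => (t d).P K)
    (α := fun c d => ⟨α c d, hα c d⟩) (β := fun d c => ⟨β d c, hβ d c⟩) hαβ
    fun c z hz => DSeq.mul_psi_of_mem (hs c) hz
  have h2 := matrixMul_matrixMul (Q := fun c => (s c).P K) (P := fun d => (t d).P K)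
    (β := fun c d => ⟨α c d, hα c d⟩) (α := fun d c => ⟨β d c, hβ d c⟩) hβα
    fun c z hz => DSeq.mul_psi_of_mem (ht c) hz
  refine ⟨LinearEquiv.ofLinearMap (matrixMul _ _ fun c d => ⟨α c d, hα c d⟩)
    (matrixMul _ _ fun d c => ⟨β d c, hβ d c⟩) (LinearMap.ext h2) (LinearMap.ext h1),
    fun d z => ⟨fun h => matrixMul_mem_directSumGrading hαd h, fun h => ?_⟩⟩
  rw [← h1 z]
  exact matrixMul_mem_directSumGrading hβd h

end Matrix

end BorcherdsCartanDatum

/-! ### Degrees of the elements and shifts of the modules -/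

namespace BorcherdsCartanDatum

open KLR

variable {I : Type*} [Fintype I] [DecidableEq I] {D : BorcherdsCartanDatum I}

section Degrees

variable {K : Type*} [Field K] {i j : I} {m : ℕ} (hi : D.IsReal i)
  {a b p n k : ℕ} {d : ℤ}
  {z : D.KLR K (Pi.single i m + Pi.single j 1)}

theorem T_mul_e_mem_grading {ν : I → ℕ} {k : ℕ} (hk : k < height ν - 1) (s : WSeq ν) :
    T D K k * e D K s ∈ grading D K (-D.dot (s.1 (WSeq.lo ⟨k, hk⟩)) (s.1 (WSeq.hi ⟨k, hk⟩))) := by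
  rw [T_mul_e hk]
  exact gen_mem_grading (.tau ⟨k, hk⟩ s)

theorem X_mul_e_mem_grading {ν : I → ℕ} {k : ℕ} (hk : k < height ν) (s : WSeq ν) :
    X D K k * e D K s ∈ grading D K (2 * D.r (s.1 ⟨k, hk⟩)) := by
  rw [X_mul_e hk]
  exact gen_mem_grading (.x ⟨k, hk⟩ s)

theorem e_mem_grading {ν : I → ℕ} (s : WSeq ν) : e D K s ∈ grading D K 0 :=
  gen_mem_grading (.e s)

theorem T_mul_mem_grading (h : k + 1 < a ∧ a ≤ m ∨ a < k ∧ k < m)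
    (hz : e D K (serreWSeq hi j m a) * z = z) (hd : z ∈ grading D K d) :
    T D K k * z ∈ grading D K (d - 2 * D.r i) := by
  have hk : k < height (Pi.single i m + Pi.single j 1 : I → ℕ) - 1 := by
    rw [height_serre]; omega
  have h1 := mul_mem_grading (T_mul_e_mem_grading hk (serreWSeq hi j m a)) hd
  rw [serreWSeq_apply hi j (by omega), serreWSeq_apply hi j (by omega),
    if_neg (by simp only [WSeq.lo]; omega), if_neg (by simp only [WSeq.hi]; omega), dot, hi,
    mul_assoc, hz] at h1
  rwa [show d - 2 * D.r i = -(D.r i * 2) + d by ring]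

theorem T_mul_mem_grading_self (ha : a < m) (hm : (m : ℤ) = 1 - D.A i j)
    (hz : e D K (serreWSeq hi j m a) * z = z) (hd : z ∈ grading D K d) :
    T D K a * z ∈ grading D K (d + D.r i * (m - 1)) := by
  have hk : a < height (Pi.single i m + Pi.single j 1 : I → ℕ) - 1 := by
    rw [height_serre]; omega
  have h1 := mul_mem_grading (T_mul_e_mem_grading hk (serreWSeq hi j m a)) hd
  rw [serreWSeq_apply hi j (by omega), serreWSeq_apply hi j (by omega),
    if_pos (by simp only [WSeq.lo]), if_neg (by simp only [WSeq.hi]; omega), dot, D.symm j i,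
    mul_assoc, hz] at h1
  rwa [hm, show d + D.r i * (1 - D.A i j - 1) = -(D.r i * D.A i j) + d by ring]

theorem T_mul_mem_grading_succ (ha : a < m) (hm : (m : ℤ) = 1 - D.A i j)
    (hz : e D K (serreWSeq hi j m (a + 1)) * z = z) (hd : z ∈ grading D K d) :
    T D K a * z ∈ grading D K (d + D.r i * (m - 1)) := by
  have hk : a < height (Pi.single i m + Pi.single j 1 : I → ℕ) - 1 := by
    rw [height_serre]; omega
  have h1 := mul_mem_grading (T_mul_e_mem_grading hk (serreWSeq hi j m (a + 1))) hd
  rw [serreWSeq_apply hi j (by omega), serreWSeq_apply hi j (by omega),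
    if_neg (by simp only [WSeq.lo]; omega), if_pos (by simp only [WSeq.hi]), dot,
    mul_assoc, hz] at h1
  rwa [hm, show d + D.r i * (1 - D.A i j - 1) = -(D.r i * D.A i j) + d by ring]

theorem X_pow_mul_mem_grading (h : k < a ∧ a ≤ m ∨ a < k ∧ k ≤ m)
    (hz : e D K (serreWSeq hi j m a) * z = z) (hd : z ∈ grading D K d) (c : ℕ) :
    X D K k ^ c * z ∈ grading D K (d + 2 * D.r i * c) := by
  have hk : k < height (Pi.single i m + Pi.single j 1 : I → ℕ) := by
    rw [height_serre]; omega
  induction c with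
  | zero => simpa using hd
  | succ c ih =>
    have h1 := mul_mem_grading (X_mul_e_mem_grading hk (serreWSeq hi j m a)) ih
    rw [serreWSeq_apply hi j (by omega), if_neg (show ¬k = a by omega), mul_assoc (X D K k),
      ((commute_e_X k _).pow_right c).left_comm, hz, ← mul_assoc, ← pow_succ'] at h1
    rwa [show d + 2 * D.r i * ((c + 1 : ℕ) : ℤ) = 2 * D.r i + (d + 2 * D.r i * c) by
      push_cast; ring]

theorem desc_mul_mem_grading (hij : i ≠ j) (hm : (m : ℤ) = 1 - D.A i j)
    (h : p + n < a ∧ a ≤ m ∨ a < p ∧ p + n ≤ m)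
    (hz : e D K (serreWSeq hi j m a) * z = z) (hd : z ∈ grading D K d) :
    NilHecke.desc (T D K) p n * z ∈ grading D K (d - 2 * D.r i * n) := by
  have S := serreRelations K hi hij hm
  induction n with
  | zero => simpa [NilHecke.desc] using hd
  | succ n ih =>
    rw [NilHecke.desc, mul_assoc _ _ z]
    have := T_mul_mem_grading hi (k := p + n) (by omega) (S.e_mul_desc (by omega) hz)
      (ih (by omega))
    rwa [show d - 2 * D.r i * ((n + 1 : ℕ) : ℤ) = d - 2 * D.r i * n - 2 * D.r i by
      push_cast; ring]

theorem asc_mul_mem_grading (hij : i ≠ j) (hm : (m : ℤ) = 1 - D.A i j)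
    (h : p + n < a ∧ a ≤ m ∨ a < p ∧ p + n ≤ m)
    (hz : e D K (serreWSeq hi j m a) * z = z) (hd : z ∈ grading D K d) :
    NilHecke.asc (T D K) p n * z ∈ grading D K (d - 2 * D.r i * n) := by
  have S := serreRelations K hi hij hm
  induction n generalizing z d with
  | zero => simpa [NilHecke.asc] using hd
  | succ n ih =>
    rw [NilHecke.asc, mul_assoc _ _ z]
    have := ih (by omega) (S.e_mul_t (by omega) hz)
      (T_mul_mem_grading hi (k := p + n) (by omega) hz hd)
    rwa [show d - 2 * D.r i * ((n + 1 : ℕ) : ℤ) = d - 2 * D.r i - 2 * D.r i * n by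
      push_cast; ring]

theorem long_mul_mem_grading (hij : i ≠ j) (hm : (m : ℤ) = 1 - D.A i j)
    (h : p + n ≤ a ∧ a ≤ m ∨ a < p ∧ p + n ≤ m + 1)
    (hz : e D K (serreWSeq hi j m a) * z = z) (hd : z ∈ grading D K d) :
    NilHecke.long (T D K) p n * z ∈ grading D K (d - 2 * D.r i * n.choose 2) := by
  have S := serreRelations K hi hij hm
  induction n generalizing z d with
  | zero => simpa [NilHecke.long] using hd
  | succ n ih =>
    rw [NilHecke.long, mul_assoc _ _ z]
    have := ih (by omega) (S.e_mul_desc (by omega) hz)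
      (desc_mul_mem_grading hi hij hm (p := p) (n := n) (by omega) hz hd)
    rwa [show d - 2 * D.r i * ((n + 1).choose 2 : ℕ) = d - 2 * D.r i * n -
      2 * D.r i * n.choose 2 by
        rw [Nat.choose_succ_succ' n 1, Nat.choose_one_right]; push_cast; ring]

theorem stair_mul_mem_grading (hij : i ≠ j) (hm : (m : ℤ) = 1 - D.A i j)
    (h : p + n ≤ a ∧ a ≤ m ∨ a < p ∧ p + n ≤ m + 1)
    (hz : e D K (serreWSeq hi j m a) * z = z) (hd : z ∈ grading D K d) :
    NilHecke.stair (X D K) p n * z ∈ grading D K (d + 2 * D.r i * n.choose 2) := by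
  have S := serreRelations K hi hij hm
  induction n generalizing p with
  | zero => simpa [NilHecke.stair] using hd
  | succ n ih =>
    rw [NilHecke.stair, mul_assoc _ _ z]
    have := X_pow_mul_mem_grading hi (k := p) (by omega) (S.e_mul_stair hz)
      (ih (p := p + 1) (by omega)) n
    rwa [show d + 2 * D.r i * ((n + 1).choose 2 : ℕ) = d + 2 * D.r i * n.choose 2 +
      2 * D.r i * n by rw [Nat.choose_succ_succ' n 1, Nat.choose_one_right]; push_cast; ring]

/-- In each block of n strands the n(n-1)/2 crossings have degree -2r_i each and the n(n-1)/2 dots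
of the staircase 2r_i each, which cancel. -/
theorem blocks_mul_mem_grading (hij : i ≠ j) (hm : (m : ℤ) = 1 - D.A i j) (h : a + b = m)
    (hz : e D K (serreWSeq hi j m a) * z = z) (hd : z ∈ grading D K d) :
    NilHecke.blocks (T D K) (X D K) a b * z ∈ grading D K d := by
  have S := serreRelations K hi hij hm
  simp only [NilHecke.blocks, mul_assoc]
  have h1 := stair_mul_mem_grading hi hij hm (p := a + 1) (n := b) (by omega) hz hd
  have e1 := S.e_mul_stair (p := a + 1) (n := b) hz
  have h2 := long_mul_mem_grading hi hij hm (p := a + 1) (n := b) (by omega) e1 h1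
  have e2 := S.e_mul_long (p := a + 1) (n := b) (by omega) e1
  have h3 := stair_mul_mem_grading hi hij hm (p := 0) (n := a) (by omega) e2 h2
  have e3 := S.e_mul_stair (p := 0) (n := a) e2
  have h4 := long_mul_mem_grading hi hij hm (p := 0) (n := a) (by omega) e3 h3
  convert h4 using 2
  ring

/-- The crossing with `j` contributes -i·j = r_i(m - 1), and the m - a - 1 crossings inside the
right block contribute -2r_i each. -/
theorem up_mem_grading (hij : i ≠ j) (hm : (m : ℤ) = 1 - D.A i j) (h : a < m) :
    NilHecke.up (T D K) (X D K) (fun a => e D K (serreWSeq hi j m a)) m a ∈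
      grading D K (D.r i * (2 * a + 1 - m)) := by
  obtain ⟨b, rfl⟩ : ∃ b, m = a + (b + 1) := ⟨m - a - 1, by omega⟩
  have S := serreRelations K hi hij hm
  have he := S.e_e (a + 1) (by omega)
  rw [NilHecke.up, show a + (b + 1) - a = b + 1 by omega,
    show a + (b + 1) - (a + 1) = b by omega, NilHecke.desc_succ', mul_assoc]
  have h1 := blocks_mul_mem_grading hi hij hm (b := b) (by omega) he (e_mem_grading _)
  have h2 := T_mul_mem_grading_succ hi (by omega) hm (S.e_mul_blocks (b := b) (by omega) he) h1
  have h3 := desc_mul_mem_grading hi hij hm (p := a + 1) (n := b) (a := a) (by omega)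
    (S.e_mul_t_self (by omega) (S.e_mul_blocks (b := b) (by omega) he)) h2
  convert h3 using 2
  push_cast
  ring

theorem down_mem_grading (hij : i ≠ j) (hm : (m : ℤ) = 1 - D.A i j) (h : a < m) :
    NilHecke.down (T D K) (X D K) (fun a => e D K (serreWSeq hi j m a)) m a ∈
      grading D K (-(D.r i * (2 * a + 1 - m))) := by
  have S := serreRelations K hi hij hm
  have he := S.e_e a (by omega)
  rw [NilHecke.down, NilHecke.asc, mul_assoc, zero_add]
  have h1 := blocks_mul_mem_grading hi hij hm (b := m - a) (by omega) he (e_mem_grading _)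
  have h2 := T_mul_mem_grading_self hi h hm (S.e_mul_blocks (b := m - a) (by omega) he) h1
  have h3 := asc_mul_mem_grading hi hij hm (p := 0) (n := a) (a := a + 1) (by omega)
    (S.e_mul_succ_t h (S.e_mul_blocks (b := m - a) (by omega) he)) h2
  convert h3 using 2
  ring

end Degrees

theorem neg_one_pow_mul_mem {K R : Type*} [Field K] [Ring R] [Module K R] (N : Submodule K R)
    (a : ℕ) {z : R} (hz : z ∈ N) : (-1) ^ a * z ∈ N := by
  rcases neg_one_pow_eq_or R a with h | h
  · rwa [h, one_mul]
  · rw [h, neg_one_mul]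
    exact N.neg_mem hz

/-! ### The isomorphism of part (1) -/

section Serre

variable (K : Type*) [Field K] {i j : I} {m : ℕ} (hi : D.IsReal i) {a b c : ℕ}

theorem shift_serreSeq (h : a + b = m) : (D.serreSeq hi j a b m h).shift =
    D.r i * (a.choose 2 + b.choose 2) := by
  simp only [DSeq.shift, serreSeq, Nat.choose_two_right, List.map_cons, List.map_nil,
    List.sum_cons, List.sum_nil]
  push_cast
  ring

/-- The binomial coefficients change by a and -b, where a - b = 2a + 1 - m; this is the degree of
`up`. -/
theorem shift_serreSeq_succ_sub (h : a + (b + 1) = m) (h' : a + 1 + b = m) :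
    (D.serreSeq hi j (a + 1) b m h').shift - (D.serreSeq hi j a (b + 1) m h).shift =
      D.r i * (2 * a + 1 - m) := by
  rw [shift_serreSeq, shift_serreSeq, Nat.choose_succ_succ' a 1, Nat.choose_succ_succ' b 1,
    Nat.choose_one_right, Nat.choose_one_right, ← h]
  push_cast
  ring

/-- The matrix of the categorified Serre relation, in `R(mi + j)`. -/
noncomputable def serreMat (hi : D.IsReal i) (j : I) (m a b : ℕ) :
    D.KLR K (Pi.single i m + Pi.single j 1) :=
  NilHecke.serreMatrix (T D K) (X D K) (fun a => e D K (serreWSeq hi j m a)) m a b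

theorem serreMat_mem (hij : i ≠ j) (hm : (m : ℤ) = 1 - D.A i j) {b' : ℕ} (h : b + b' = m) :
    serreMat K hi j m a b ∈ (D.serreSeq hi j b b' m h).P K := by
  rw [DSeq.P, psi_idem_serreSeq hi hij hm]
  have hb : b' = m - b := by omega
  subst hb
  rw [serreMat, NilHecke.serreMatrix]
  refine Submodule.add_mem _ ?_ ?_
  · split_ifs with hab
    · subst hab
      rw [NilHecke.up, ← mul_assoc]
      exact Submodule.mem_span_singleton.2 ⟨_, rfl⟩
    · exact Submodule.zero_mem _
  · split_ifs with hab
    · exact Submodule.mem_span_singleton.2 ⟨_, rfl⟩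
    · exact Submodule.zero_mem _

theorem serreMat_mem_grading (hij : i ≠ j) (hm : (m : ℤ) = 1 - D.A i j)
    {a' b' : ℕ} (h : a + a' = m) (h' : b + b' = m) :
    serreMat K hi j m a b ∈ grading D K
      ((D.serreSeq hi j b b' m h').shift - (D.serreSeq hi j a a' m h).shift) := by
  rw [serreMat, NilHecke.serreMatrix]
  refine Submodule.add_mem _ ?_ ?_
  · split_ifs with hab
    · subst hab
      obtain rfl : a' = b' + 1 := by omega
      rw [shift_serreSeq_succ_sub]
      have := up_mem_grading (K := K) hi hij hm (a := a) (by omega)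
      exact neg_one_pow_mul_mem _ a this
    · exact Submodule.zero_mem _
  · split_ifs with hab
    · subst hab
      obtain rfl : b' = a' + 1 := by omega
      rw [← neg_sub, shift_serreSeq_succ_sub]
      exact down_mem_grading hi hij hm (by omega)
    · exact Submodule.zero_mem _

theorem psi_idem_serreSeq_mul_self (hij : i ≠ j) (hm : (m : ℤ) = 1 - D.A i j) (h : a + b = m) :
    psi D K ((D.serreSeq hi j a b m h).idem K) * psi D K ((D.serreSeq hi j a b m h).idem K) =
      psi D K ((D.serreSeq hi j a b m h).idem K) := by
  have S := serreRelations K hi hij hm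
  have he := S.e_e a (by omega)
  rw [psi_idem_serreSeq hi hij hm, mul_assoc]
  have h1 := S.e_mul_blocks h he
  rw [h1]
  exact S.blocks_idem h he

theorem sum_serreMat (hij : i ≠ j) (hm : (m : ℤ) = 1 - D.A i j)
    {a' : ℕ} (h : a + a' = m) (hc : c ≤ m) :
    ∑ b ∈ Finset.range (m + 1), serreMat K hi j m a b * serreMat K hi j m b c =
      if a = c then psi D K ((D.serreSeq hi j a a' m h).idem K) else 0 := by
  obtain rfl : a' = m - a := by omega
  rw [psi_idem_serreSeq hi hij hm]
  have := D.off_diag i j hij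
  exact (serreRelations K hi hij hm).serreMatrix_sq (by omega) (by omega) hc

end Serre

/-- This and its odd analogue identify a sum over one summation range of the proposition with a sum
over all of 0, …, m when the terms of the other parity vanish. -/
theorem sum_range_eq_sum_even {R : Type*} [AddCommMonoid R] {m : ℕ} {g : ℕ → R}
    (h : ∀ b, b % 2 = 1 → g b = 0) :
    ∑ c : Fin (m / 2 + 1), g (2 * c) = ∑ b ∈ Finset.range (m + 1), g b := by
  refine Finset.sum_of_injOn (fun c : Fin (m / 2 + 1) => 2 * (c : ℕ)) ?_ ?_ ?_ fun _ _ => rfl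
  · intro a _ b _ hab
    simp only at hab
    exact Fin.ext (by omega)
  · intro a _
    simp only [Finset.coe_range, Set.mem_Iio]
    omega
  · intro b hb hb'
    rw [Finset.mem_range] at hb
    refine h b ?_
    by_contra hcon
    exact hb' ⟨⟨b / 2, by omega⟩, by simp, by simp only; omega⟩

theorem sum_range_eq_sum_odd {R : Type*} [AddCommMonoid R] {m : ℕ} (hm : 0 < m) {g : ℕ → R}
    (h : ∀ b, b % 2 = 0 → g b = 0) :
    ∑ c : Fin ((m - 1) / 2 + 1), g (2 * c + 1) = ∑ b ∈ Finset.range (m + 1), g b := by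
  refine Finset.sum_of_injOn (fun c : Fin ((m - 1) / 2 + 1) => 2 * (c : ℕ) + 1) ?_ ?_ ?_
    fun _ _ => rfl
  · intro a _ b _ hab
    simp only at hab
    exact Fin.ext (by omega)
  · intro a _
    simp only [Finset.coe_range, Set.mem_Iio]
    omega
  · intro b hb hb'
    rw [Finset.mem_range] at hb
    refine h b ?_
    by_contra hcon
    exact hb' ⟨⟨b / 2, by omega⟩, by simp, by simp only; omega⟩

theorem serreMat_eq_zero {K : Type*} [Field K] {i j : I} (hi : D.IsReal i) {m a b : ℕ}
    (h : a % 2 = b % 2) : serreMat K hi j m a b = 0 :=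
  NilHecke.serreMatrix_eq_zero _ _ _ _ h

/-- The even-to-odd and odd-to-even parts of one matrix serve as the two homomorphisms. For an entry
of the square between indices of equal parity, the intermediate index has the other parity, so
summing over that parity loses nothing. -/
theorem gradedIso_serre (K : Type*) [Field K] {i j : I} (hi : D.IsReal i) (hij : i ≠ j) {m : ℕ}
    (hm : (m : ℤ) = 1 - D.A i j) (h0 : 0 < m)
    (h1 : ∀ c : Fin (m / 2 + 1), 2 * (c : ℕ) + (m - 2 * c) = m)
    (h2 : ∀ c : Fin ((m - 1) / 2 + 1), 2 * (c : ℕ) + 1 + (m - 2 * c - 1) = m) :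
    GradedIso (D.KLR K (Pi.single i m + Pi.single j 1))
      (directSumGrading K fun c : Fin (m / 2 + 1) =>
        (D.serreSeq hi j (2 * c) (m - 2 * c) m (h1 c)).PGrading K)
      (directSumGrading K fun c : Fin ((m - 1) / 2 + 1) =>
        (D.serreSeq hi j (2 * c + 1) (m - 2 * c - 1) m (h2 c)).PGrading K) := by
  refine gradedIso_of_matrix (α := fun c d => serreMat K hi j m (2 * c) (2 * d + 1))
    (β := fun d c => serreMat K hi j m (2 * d + 1) (2 * c))
    (fun c d => serreMat_mem K hi hij hm _) (fun d c => serreMat_mem K hi hij hm _)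
    (fun c d => serreMat_mem_grading K hi hij hm _ _)
    (fun d c => serreMat_mem_grading K hi hij hm _ _) (fun c c' => ?_) (fun d d' => ?_)
    (fun c => psi_idem_serreSeq_mul_self K hi hij hm _)
    (fun d => psi_idem_serreSeq_mul_self K hi hij hm _)
  · rw [sum_range_eq_sum_odd h0 (g := fun b => serreMat K hi j m (2 * c) b *
      serreMat K hi j m b (2 * c')) fun b hb => by
        rw [serreMat_eq_zero hi (by omega), zero_mul],
      sum_serreMat K hi hij hm (a' := m - 2 * c) (by omega) (by omega)]
    simp only [Fin.ext_iff, mul_right_inj' two_ne_zero]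
  · rw [sum_range_eq_sum_even (g := fun b => serreMat K hi j m (2 * d + 1) b *
      serreMat K hi j m b (2 * d' + 1)) fun b hb => by
        rw [serreMat_eq_zero hi (by omega), zero_mul],
      sum_serreMat K hi hij hm (a' := m - 2 * d - 1) (by omega) (by omega)]
    simp only [Fin.ext_iff, add_left_inj, mul_right_inj' two_ne_zero]

/-! ### The isomorphism of part (2) -/

section Pair

variable {K : Type*} [Field K] {i j : I}

theorem psi_idem_of_blocks {ν : I → ℕ} {s : D.DSeq ν} (h : s.blocks = [(i, 1), (j, 1)]) :
    psi D K (s.idem K) = e D K s.hat := by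
  rw [DSeq.idem, h, psi_mul, psi_e]
  simp [blockIdem, nilIdem_one, psi_one]

theorem gradedIso_pair (hd : D.dot i j = 0) :
    GradedIso (D.KLR K (Pi.single i 1 + Pi.single j 1))
      ((D.pairSeq i j).PGrading K) ((D.pairSeq' i j).PGrading K) := by
  by_cases hij : i = j
  · subst hij
    -- An index with i·i = 0 is allowed; then τ² = 0 on the sequence `i i`, but the two modules
    -- coincide.
    exact ⟨LinearEquiv.refl _ _, fun _ _ => Iff.rfl⟩
  have hk : 0 < height (Pi.single i 1 + Pi.single j 1 : I → ℕ) - 1 := by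
    rw [height_serre]; omega
  have h1 := psi_idem_of_blocks (K := K) (s := D.pairSeq i j) rfl
  have h2 := psi_idem_of_blocks (K := K) (s := D.pairSeq' i j) rfl
  have a1 : (D.pairSeq i j).hat.1 (WSeq.lo ⟨0, hk⟩) = i := rfl
  have a2 : (D.pairSeq i j).hat.1 (WSeq.hi ⟨0, hk⟩) = j := rfl
  have b1 : (D.pairSeq' i j).hat.1 (WSeq.lo ⟨0, hk⟩) = j := rfl
  have b2 : (D.pairSeq' i j).hat.1 (WSeq.hi ⟨0, hk⟩) = i := rfl
  have hd' : D.dot j i = 0 := (D.symm i j).symm.trans hd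
  have hsw : WSeq.sw ⟨0, hk⟩ (D.pairSeq i j).hat = (D.pairSeq' i j).hat := by
    apply Subtype.ext
    funext t
    have ht := t.2.trans_eq (height_serre i j 1)
    by_cases ht0 : t = WSeq.lo ⟨0, hk⟩
    · rw [ht0, WSeq.sw_lo, a2, b1]
    · have ht1 : t = WSeq.hi ⟨0, hk⟩ := by
        rw [Fin.ext_iff] at ht0 ⊢
        simp only [WSeq.lo, WSeq.hi] at ht0 ⊢
        omega
      rw [ht1, WSeq.sw_hi, a1, b2]
  have hsw' : WSeq.sw ⟨0, hk⟩ (D.pairSeq' i j).hat = (D.pairSeq i j).hat := by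
    rw [← hsw, WSeq.sw_sw]
  have hs1 : (D.pairSeq i j).shift = 0 := by simp [DSeq.shift, pairSeq]
  have hs2 : (D.pairSeq' i j).shift = 0 := by simp [DSeq.shift, pairSeq']
  have t1 := T_mul_e_mem_grading (D := D) (K := K) hk (D.pairSeq i j).hat
  have t2 := T_mul_e_mem_grading (D := D) (K := K) hk (D.pairSeq' i j).hat
  rw [a1, a2, hd, neg_zero] at t1
  rw [b1, b2, hd', neg_zero] at t2
  have q1 := T_sq_of_dot_eq_zero (D := D) (K := K) hk (s := (D.pairSeq i j).hat)
    (by rwa [a1, a2]) (by rw [a1, a2, hd])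
  have q2 := T_sq_of_dot_eq_zero (D := D) (K := K) hk (s := (D.pairSeq' i j).hat)
    (by rw [b1, b2]; exact Ne.symm hij) (by rw [b1, b2, hd'])
  have c1 := e_mul_T (D := D) (K := K) hk (D.pairSeq i j).hat
  have c2 := e_mul_T (D := D) (K := K) hk (D.pairSeq' i j).hat
  rw [hsw] at c1
  rw [hsw'] at c2
  -- The two maps are the crossings with bottom sequence `j i` and `i j`; both composites are τ²,
  -- which is the identity for orthogonal distinct colours.
  refine gradedIso_of_mul_eq (u := T D K 0 * e D K (D.pairSeq' i j).hat)
    (v := T D K 0 * e D K (D.pairSeq i j).hat) ?_ ?_ ?_ ?_ ?_ ?_ ?_ ?_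
  · rw [DSeq.P, h2]
    exact Submodule.mem_span_singleton.2 ⟨_, rfl⟩
  · rw [DSeq.P, h1]
    exact Submodule.mem_span_singleton.2 ⟨_, rfl⟩
  · rwa [hs1, hs2, sub_zero]
  · rwa [hs1, hs2, sub_zero]
  · rw [h1, ← c2, mul_assoc, ← mul_assoc (T D K 0), q1, e_mul_self]
  · rw [h2, ← c1, mul_assoc, ← mul_assoc (T D K 0), q2, e_mul_self]
  · rw [h1, e_mul_self]
  · rw [h2, e_mul_self]

end Pair

end BorcherdsCartanDatum

theorem mainTheorem9 (K : Type*) [Field K] [IsAlgClosed K] {I : Type*} [Fintype I] [DecidableEq I]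
    (D : BorcherdsCartanDatum I) :
    (∀ (i j : I) (hi : D.IsReal i) (hij : i ≠ j) (m : ℕ) (hm : (m : ℤ) = 1 - D.A i j),
      GradedIso (D.KLR K (Pi.single i m + Pi.single j 1))
        (directSumGrading K fun c : Fin (m / 2 + 1) =>
          (D.serreSeq hi j (2 * c) (m - 2 * c) m (by omega)).PGrading K)
        (directSumGrading K fun c : Fin ((m - 1) / 2 + 1) =>
          (D.serreSeq hi j (2 * c + 1) (m - 2 * c - 1) m
            (by have := D.off_diag i j hij; omega)).PGrading K)) ∧
    (∀ i j : I, D.dot i j = 0 →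
      GradedIso (D.KLR K (Pi.single i 1 + Pi.single j 1))
        ((D.pairSeq i j).PGrading K) ((D.pairSeq' i j).PGrading K)) := by
  refine ⟨fun i j hi hij m hm => ?_, fun i j hd => BorcherdsCartanDatum.gradedIso_pair hd⟩
  -- Since a_{ij} ≤ 0, this gives m ≥ 1, so that the truncated m - 1 in the second index range is
  -- the true difference.
  have := D.off_diag i j hij
  exact BorcherdsCartanDatum.gradedIso_serre K hi hij hm (by omega) _ _
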